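/- Notation. A rational (lattice) polytope in $\mathbb{R}^n$ is the convex hull of a finite set of points such that all its vertices lie in $\mathbb{Q}^n$ (in $\mathbb{Z}^n$). For a rational polytope $P\subset\mathbb{R}^n$, $\operatorname{den}P$ is the smallest positive integer $k$ such that $kP$ is a lattice polytope, $\operatorname{Ehr}_P(t)=1+\sum_{k\ge 1}|kP\cap\mathbb{Z}^n|\,t^k$ is its Ehrhart series, and $\delta_P$ is the unique polynomial with $\operatorname{Ehr}_P(t)=\delta_P(t)/(1-t^{\operatorname{den}P})^{\dim P+1}$ (which exists by Ehrhart's theorem). For $P,Q\subset\mathbb{R}^n$ let $P\oplus Q$ be the convex hull of $P\cup Q$. We say that $P\oplus Q$ is a free sum if there is $A\in \mathsf{SL}_n(\mathbb{Z})$ such that $AP$ and $AQ$ both contain the origin and their linear spans are orthogonal coordinate subspaces (subspaces spanned by disjoint subsets of the standard basis). For a polytope $P$ containing the origin, with linear span $\operatorname{lin}P$, let $P^\vee=\{\varphi\in(\operatorname{lin}P)^*:\varphi(a)\le 1\text{ for all }a\in P\}$; it is called a lattice polyhedron if each of its vertices $\varphi$ satisfies $\varphi(a)\in\mathbb{Z}$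 for all $a\in\operatorname{lin}P\cap\mathbb{Z}^n$. Theorem. Let $P,Q\subset\mathbb{R}^n$ be rational polytopes such that $P\oplus Q$ is a free sum. If $P^\vee$ or $Q^\vee$ is a lattice polyhedron, then $$\operatorname{Ehr}_{P\oplus Q}(t)=(1-t)\operatorname{Ehr}_P(t)\operatorname{Ehr}_Q(t)\qquad(1)$$ and $$\delta_{P\oplus Q}(t)=\frac{(1-t)\,(1-t^{\operatorname{lcm}(\operatorname{den}P,\operatorname{den}Q)})^{\dim P+\dim Q+1}}{(1-t^{\operatorname{den}P})^{\dim P+1}(1-t^{\operatorname{den}Q})^{\dim Q+1}}\,\delta_P(t)\,\delta_Q(t).\qquad(2)$$ Conversely, if (1) or (2) holds, then $P^\vee$ or $Q^\vee$ is a lattice polyhedron. In particular, if $P,Q\subset\mathbb{R}^n$ are lattice polytopes such that $P\oplus Q$ is a free sum, then $\delta_{P\oplus Q}=\delta_P\,\delta_Q$ if and only if $P^\vee$ or $Q^\vee$ is a lattice polyhedron. -/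

import Mathlib

namespace Ehrhart

/-- A polytope in `ℝⁿ`: the convex hull of a finite set of points. -/
def IsPolytope {n : ℕ} (P : Set (Fin n → ℝ)) : Prop :=
  ∃ s : Finset (Fin n → ℝ), P = convexHull ℝ (s : Set (Fin n → ℝ))

/-- The integer lattice `ℤⁿ` in `ℝⁿ`. -/
def integerLattice (n : ℕ) : Set (Fin n → ℝ) :=
  {x | ∀ i, ∃ m : ℤ, x i = (m : ℝ)}

/-- A rational polytope: a polytope all of whose vertices are in `ℚⁿ`. -/
def IsRationalPolytope {n : ℕ} (P : Set (Fin n → ℝ)) : Prop :=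
  IsPolytope P ∧ ∀ v ∈ P.extremePoints ℝ, ∀ i, ∃ q : ℚ, v i = (q : ℝ)

/-- A lattice polytope: a polytope all of whose vertices are in `ℤⁿ`. -/
def IsLatticePolytope {n : ℕ} (P : Set (Fin n → ℝ)) : Prop :=
  IsPolytope P ∧ ∀ v ∈ P.extremePoints ℝ, v ∈ integerLattice n

/-- The dilate `c P`. -/
def dilate {n : ℕ} (c : ℝ) (P : Set (Fin n → ℝ)) : Set (Fin n → ℝ) :=
  (fun x => c • x) '' P

/-- The denominator of `P`: the smallest positive integer `k` such that `k P` is a lattice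
polytope. (Such a `k` exists for every rational polytope.) -/
noncomputable def den {n : ℕ} (P : Set (Fin n → ℝ)) : ℕ :=
  sInf {k : ℕ | 0 < k ∧ IsLatticePolytope (dilate (k : ℝ) P)}

/-- The dimension of `P`: the dimension of its affine span. -/
noncomputable def dim {n : ℕ} (P : Set (Fin n → ℝ)) : ℕ :=
  Module.finrank ℝ (vectorSpan ℝ P)

/-- The Ehrhart series `Ehr_P(t) = 1 + ∑_{k ≥ 1} |k P ∩ ℤⁿ| t ^ k`. -/
noncomputable def ehr {n : ℕ} (P : Set (Fin n → ℝ)) : PowerSeries ℚ :=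
  PowerSeries.mk fun k =>
    if k = 0 then 1 else ((dilate (k : ℝ) P ∩ integerLattice n).ncard : ℚ)

open Classical in
/-- The `δ`-polynomial of `P`: the unique polynomial `δ_P` such that
`Ehr_P(t) = δ_P(t) / (1 - t ^ den P) ^ (dim P + 1)`, written without the division. By Ehrhart's
theorem it exists for every (nonempty) rational polytope; the value `0` is used if there is
no such polynomial. -/
noncomputable def delta {n : ℕ} (P : Set (Fin n → ℝ)) : Polynomial ℚ :=
  if h : ∃ f : Polynomial ℚ,
      ehr P * (1 - PowerSeries.X ^ den P) ^ (dim P + 1) = (f : PowerSeries ℚ)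
  then h.choose else 0

/-- `P ⊕ Q`, the convex hull of the union of `P` and `Q`. -/
def oplus {n : ℕ} (P Q : Set (Fin n → ℝ)) : Set (Fin n → ℝ) :=
  convexHull ℝ (P ∪ Q)

/-- The coordinate subspace of `ℝⁿ` spanned by the standard basis vectors `e_i`, `i ∈ I`. -/
def coordSubspace {n : ℕ} (I : Finset (Fin n)) : Submodule ℝ (Fin n → ℝ) :=
  Submodule.span ℝ ((fun i : Fin n => (Pi.single i 1 : Fin n → ℝ)) '' (I : Set (Fin n)))

/-- `P` and `Q` both contain the origin and their linear spans are orthogonal coordinate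
subspaces. (Two coordinate subspaces are orthogonal exactly if they are spanned by disjoint sets
of standard basis vectors.) -/
def IsCoordFreeSum {n : ℕ} (P Q : Set (Fin n → ℝ)) : Prop :=
  (0 : Fin n → ℝ) ∈ P ∧ (0 : Fin n → ℝ) ∈ Q ∧
    ∃ I J : Finset (Fin n), Disjoint I J ∧
      Submodule.span ℝ P = coordSubspace I ∧ Submodule.span ℝ Q = coordSubspace J

/-- The image of `P` under the action of `A ∈ SL_n(ℤ)` on `ℝⁿ`. -/
def slImage {n : ℕ} (A : Matrix.SpecialLinearGroup (Fin n) ℤ) (P : Set (Fin n → ℝ)) :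
    Set (Fin n → ℝ) :=
  (fun x => ((A : Matrix (Fin n) (Fin n) ℤ).map (fun m : ℤ => (m : ℝ))).mulVec x) '' P

/-- `P ⊕ Q` is a free sum (of the convex sets `P` and `Q`): after applying one element of
`SL_n(ℤ)` to both, `P` and `Q` contain the origin and their linear spans are orthogonal
coordinate subspaces. -/
def IsFreeSum {n : ℕ} (P Q : Set (Fin n → ℝ)) : Prop :=
  ∃ A : Matrix.SpecialLinearGroup (Fin n) ℤ, IsCoordFreeSum (slImage A P) (slImage A Q)

/-- The polar dual `P^∨`, relative to the linear span of `P`: the set of linear functionals `φ`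
on `lin P` with `φ a ≤ 1` for all `a ∈ P`. -/
def polarDual {n : ℕ} (P : Set (Fin n → ℝ)) :
    Set (Module.Dual ℝ (Submodule.span ℝ P)) :=
  {φ | ∀ a : Submodule.span ℝ P, (a : Fin n → ℝ) ∈ P → φ a ≤ 1}

/-- The dual integer lattice: the linear functionals on `lin P` that take integer values at all
integer lattice points of `lin P`. -/
def dualLattice {n : ℕ} (P : Set (Fin n → ℝ)) :
    Set (Module.Dual ℝ (Submodule.span ℝ P)) :=
  {φ | ∀ a : Submodule.span ℝ P, (a : Fin n → ℝ) ∈ integerLattice n → ∃ m : ℤ, φ a = (m : ℝ)}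

/-- `P^∨` is a lattice polyhedron: its vertices are in the dual integer lattice. -/
def DualIsLatticePolyhedron {n : ℕ} (P : Set (Fin n → ℝ)) : Prop :=
  ∀ φ ∈ (polarDual P).extremePoints ℝ, φ ∈ dualLattice P

/-- The equation `Ehr_{P ⊕ Q}(t) = (1 - t) Ehr_P(t) Ehr_Q(t)`. -/
def EhrhartEquation {n : ℕ} (P Q : Set (Fin n → ℝ)) : Prop :=
  ehr (oplus P Q) = (1 - PowerSeries.X) * ehr P * ehr Q

/-- The equation of rational functions in `t`
`δ_{P ⊕ Q} = (1 - t) (1 - t ^ lcm (den P) (den Q)) ^ (dim P + dim Q + 1) /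
  ((1 - t ^ den P) ^ (dim P + 1) (1 - t ^ den Q) ^ (dim Q + 1)) * δ_P * δ_Q`. -/
def DeltaEquation {n : ℕ} (P Q : Set (Fin n → ℝ)) : Prop :=
  algebraMap (Polynomial ℚ) (RatFunc ℚ) (delta (oplus P Q)) =
    ((1 - RatFunc.X) * (1 - RatFunc.X ^ Nat.lcm (den P) (den Q)) ^ (dim P + dim Q + 1)) /
      ((1 - RatFunc.X ^ den P) ^ (dim P + 1) * (1 - RatFunc.X ^ den Q) ^ (dim Q + 1)) *
      algebraMap (Polynomial ℚ) (RatFunc ℚ) (delta P) *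
      algebraMap (Polynomial ℚ) (RatFunc ℚ) (delta Q)

end Ehrhart

open Ehrhart

/-!
Write `‖x‖_P = min {a ≥ 0 | x ∈ a P}` for the gauge of `P`, which is finite on the cone over `P`.
Both sides of the equation of Ehrhart series count pairs `(x, y)` of lattice points of the linear
spans of `P` and `Q`. The coefficient of `t ^ k` in `Ehr_{P ⊕ Q}` counts the pairs with
`‖x‖_P + ‖y‖_Q ≤ k`, because `k (P ⊕ Q)` is the union of the sets `a P + b Q` with `a + b = k` and
because the lattice of the sum of the two spans is the sum of their lattices. The coefficient of
`t ^ k` in `(1 - t) Ehr_P Ehr_Q` counts the pairs with `⌈‖x‖_P⌉ + ⌈‖y‖_Q⌉ ≤ k`, which is a stronger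
condition. Hence the equation holds if and only if the two conditions agree for all `k`
(`ehrhartEquation_iff_latticePointsSplit`). If one of the gauges is integral on lattice points, they
agree. Otherwise there are lattice points `x` and `y` at which the fractional parts of the gauges
lie in `(0, 1/2]`, as suitable multiples of arbitrary points with non-integral gauges show, and the
conditions differ at this pair (`LatticePointsSplit.isGaugeIntegral_or`).

The gauge of `P` is integral on lattice points if and only if `P^∨` is a lattice polyhedron
(`dualIsLatticePolyhedron_iff`). By separation and a descent to vertices, `‖x‖_P` is the maximum of
`φ x` over the vertices `φ` of `P^∨` (`exists_dual_gt`, `exists_extremePoint_ge`). Conversely, a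
vertex `φ` agrees with the gauge on the cone over the points at which it is tight; these span
`lin P`, so every lattice point is a difference of two lattice points of this cone.

The equation of `δ`-polynomials is the equation of Ehrhart series with denominators cleared, once
it is known that `δ_P` has its defining property, that `den (P ⊕ Q)` is the least common multiple of
`den P` and `den Q` (`den_oplus`), and that dimensions add. The first of these facts is Ehrhart's
theorem (`exists_polynomial_ehr_convexHull_range`). It is proved by representing each lattice point
of the cone over `P × {1}` by its lexicographically smallest conical combination of the vertices.
Whether a representation is smallest depends only on its support, and the supports that occur are
affinely independent. This decomposes the cone into open simplicial cones, of dimension at most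
`dim P + 1`, whose generating functions are computed by translating along the generators.
-/

open Ehrhart

namespace Ehrhart

/-! ### Lexicographically minimal conical representations -/

section LexNeg

variable {ι : Type*} [LinearOrder ι]

/-- `μ` is lexicographically negative: its first nonzero entry is negative. -/
def LexNeg (μ : ι → ℝ) : Prop := ∃ i, (∀ j < i, μ j = 0) ∧ μ i < 0

lemma LexNeg.smul {μ : ι → ℝ} (h : LexNeg μ) {s : ℝ} (hs : 0 < s) : LexNeg (s • μ) := by
  obtain ⟨i, h1, h2⟩ := h
  exact ⟨i, fun j hj => by simp [h1 j hj], by simpa using mul_neg_of_pos_of_neg hs h2⟩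

lemma lexNeg_sub_iff {l l' : ι → ℝ} : LexNeg (l - l') ↔ toLex l < toLex l' := by
  constructor
  · rintro ⟨i, h1, h2⟩
    exact ⟨i, fun j hj => by simpa [sub_eq_zero] using h1 j hj, by simpa using h2⟩
  · rintro ⟨i, h1, h2⟩
    exact ⟨i, fun j hj => by simpa [sub_eq_zero] using h1 j hj, by simpa using h2⟩

end LexNeg

section Lex

variable {ι E : Type*} [Fintype ι] [AddCommGroup E] [Module ℝ E]

/-- `μ` is an affine relation between the points `v i`. -/
def IsAffineRelation (v : ι → E) (μ : ι → ℝ) : Prop :=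
  ∑ i, μ i • v i = 0 ∧ ∑ i, μ i = 0

/-- The set of indices at which `l` does not vanish. -/
noncomputable def supp (l : ι → ℝ) : Finset ι := {i | l i ≠ 0}

@[simp] lemma mem_supp {l : ι → ℝ} {i : ι} : i ∈ supp l ↔ l i ≠ 0 := by
  simp [supp]

lemma IsAffineRelation.neg {v : ι → E} {μ : ι → ℝ} (h : IsAffineRelation v μ) :
    IsAffineRelation v (-μ) := by
  constructor
  · simp [h.1]
  · simp [h.2]

lemma isAffineRelation_sub {v : ι → E} {l l' : ι → ℝ}
    (h : ∑ i, l i • v i = ∑ i, l' i • v i) (h' : ∑ i, l i = ∑ i, l' i) :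
    IsAffineRelation v (l - l') := by
  constructor
  · simp [sub_smul, h]
  · simp [h']

lemma IsAffineRelation.sum_add_smul {v : ι → E} {μ : ι → ℝ} (h : IsAffineRelation v μ)
    (l : ι → ℝ) (s : ℝ) : ∑ i, (l + s • μ) i • v i = ∑ i, l i • v i := by
  have : ∑ i, (s * μ i) • v i = s • ∑ i, μ i • v i := by
    simp [Finset.smul_sum, mul_smul]
  simp [add_smul, Finset.sum_add_distrib, this, h.1]

lemma IsAffineRelation.sum_add {v : ι → E} {μ : ι → ℝ} (h : IsAffineRelation v μ)
    (l : ι → ℝ) (s : ℝ) : ∑ i, (l + s • μ) i = ∑ i, l i := by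
  simp [Finset.sum_add_distrib, ← Finset.mul_sum, h.2]

variable [LinearOrder ι]

lemma lexNeg_or_lexNeg_neg {μ : ι → ℝ} (h : μ ≠ 0) : LexNeg μ ∨ LexNeg (-μ) := by
  have hne : (supp μ).Nonempty := by
    obtain ⟨i, hi⟩ := Function.ne_iff.1 h
    exact ⟨i, by simpa using hi⟩
  have hlt : ∀ j < (supp μ).min' hne, μ j = 0 := fun j hj => by
    by_contra h0
    exact absurd (Finset.min'_le _ j (mem_supp.2 h0)) (not_le.2 hj)
  rcases lt_or_gt_of_ne (mem_supp.1 ((supp μ).min'_mem hne)) with h1 | h1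
  · exact Or.inl ⟨_, hlt, h1⟩
  · exact Or.inr ⟨_, fun j hj => by simp [hlt j hj], by simpa using h1⟩

/-- `σ` is the support of a lexicographically minimal conical representation: no lexicographically
negative relation can be added (with a small coefficient) to a representation with positive
coefficients exactly on `σ`. The open simplicial cones over these `σ` partition the cone over the
points `v i`. -/
def IsLexFace (v : ι → E) (σ : Finset ι) : Prop :=
  ∀ μ : ι → ℝ, IsAffineRelation v μ → (∀ i ∉ σ, 0 ≤ μ i) → ¬ LexNeg μ

lemma IsLexFace.eq_zero {v : ι → E} {σ : Finset ι} (h : IsLexFace v σ) {μ : ι → ℝ}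
    (hμ : IsAffineRelation v μ) (h0 : ∀ i ∉ σ, μ i = 0) : μ = 0 := by
  by_contra hne
  rcases lexNeg_or_lexNeg_neg hne with h1 | h1
  · exact h μ hμ (fun i hi => (h0 i hi).ge) h1
  · exact h (-μ) hμ.neg (fun i hi => by simp [h0 i hi]) h1

/-- Representations supported on lexicographic faces are unique. -/
lemma IsLexFace.unique {v : ι → E} {l l' : ι → ℝ} (h : IsLexFace v (supp l))
    (h' : IsLexFace v (supp l')) (hl : ∀ i, 0 ≤ l i) (hl' : ∀ i, 0 ≤ l' i)
    (h1 : ∑ i, l i • v i = ∑ i, l' i • v i) (h2 : ∑ i, l i = ∑ i, l' i) : l = l' := by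
  have key : ∀ a b : ι → ℝ, (∀ i, 0 ≤ b i) → ∀ i ∉ supp a, 0 ≤ (b - a) i := by
    intro a b hb i hi
    have : a i = 0 := by simpa using hi
    simpa [this] using hb i
  have ha := h _ (isAffineRelation_sub h1.symm h2.symm) (key l l' hl')
  have hb := h' _ (isAffineRelation_sub h1 h2) (key l' l hl)
  rw [lexNeg_sub_iff] at ha hb
  exact toLex.injective (le_antisymm (not_lt.1 ha) (not_lt.1 hb))

/-- If the support of a conical representation carries an affine relation, then moving along this
relation gives a lexicographically smaller representation with smaller support. -/
lemma exists_lex_lt_card_supp_lt {v : ι → E} {l μ : ι → ℝ} (hl : ∀ i, 0 ≤ l i)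
    (hμ : IsAffineRelation v μ) (hs : ∀ i ∉ supp l, μ i = 0) (hneg : LexNeg μ) :
    ∃ l' : ι → ℝ, (∀ i, 0 ≤ l' i) ∧ ∑ i, l' i • v i = ∑ i, l i • v i ∧
      ∑ i, l' i = ∑ i, l i ∧ toLex l' < toLex l ∧ (supp l').card < (supp l).card := by
  obtain ⟨i₀, hi₀, hmin⟩ := Finset.exists_min_image (Finset.univ.filter fun i => μ i < 0)
    (fun i => l i / (- μ i)) (by
      obtain ⟨i, -, hi⟩ := hneg
      exact ⟨i, by simpa using hi⟩)
  have hi₀' : μ i₀ < 0 := by simpa using hi₀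
  have hl₀ : l i₀ ≠ 0 := fun h => hi₀'.ne (hs i₀ (by simpa using h))
  set s : ℝ := l i₀ / (- μ i₀) with hsdef
  have hspos : 0 < s := div_pos (lt_of_le_of_ne (hl i₀) hl₀.symm) (by linarith)
  refine ⟨l + s • μ, fun i => ?_, hμ.sum_add_smul l s, hμ.sum_add l s, ?_, ?_⟩
  · rcases lt_or_ge (μ i) 0 with h | h
    · have h1 := hmin i (by simpa using h)
      rw [le_div_iff₀ (by linarith)] at h1
      simp only [Pi.add_apply, Pi.smul_apply, smul_eq_mul]
      linarith
    · have := hl i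
      simp only [Pi.add_apply, Pi.smul_apply, smul_eq_mul]
      positivity
  · rw [← lexNeg_sub_iff]
    simpa using hneg.smul hspos
  · refine Finset.card_lt_card ⟨fun i hi => ?_, fun hsub => ?_⟩
    · by_contra h
      have h1 : l i = 0 := by simpa using h
      have h2 := hs i h
      simp [h1, h2] at hi
    · have h1 := hsub (mem_supp.2 hl₀)
      have h2 : l i₀ + s * μ i₀ = 0 := by
        have : s * (- μ i₀) = l i₀ := div_mul_cancel₀ _ (by linarith)
        linarith
      simp [h2] at h1

/-- Every conical representation can be replaced by one supported on a lexicographic face: the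
lexicographically smallest one. -/
lemma exists_isLexFace_supp (v : ι → E) {l : ι → ℝ} (hl : ∀ i, 0 ≤ l i) :
    ∃ l' : ι → ℝ, (∀ i, 0 ≤ l' i) ∧ ∑ i, l' i • v i = ∑ i, l i • v i ∧
      ∑ i, l' i = ∑ i, l i ∧ IsLexFace v (supp l') := by
  -- the representations with affinely independent support: a finite set, in which every
  -- representation has a lexicographic lower bound
  let S : Set (ι → ℝ) := {l' | (∀ i, 0 ≤ l' i) ∧ ∑ i, l' i • v i = ∑ i, l i • v i ∧
      ∑ i, l' i = ∑ i, l i ∧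
      ∀ μ : ι → ℝ, IsAffineRelation v μ → (∀ i ∉ supp l', μ i = 0) → μ = 0}
  have hfin : S.Finite := by
    refine Set.Finite.of_finite_image (f := supp) (Set.toFinite _) ?_
    rintro a ⟨-, ha1, ha2, ha3⟩ b ⟨-, hb1, hb2, -⟩ hab
    refine sub_eq_zero.1 (ha3 _ (isAffineRelation_sub (ha1.trans hb1.symm)
      (ha2.trans hb2.symm)) fun i hi => ?_)
    have h1 : a i = 0 := by simpa using hi
    have h2 : b i = 0 := by
      have : i ∉ supp b := hab ▸ hi
      simpa using this
    simp [h1, h2]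
  have hdom : ∀ m : ℕ, ∀ a : ι → ℝ, (∀ i, 0 ≤ a i) → ∑ i, a i • v i = ∑ i, l i • v i →
      ∑ i, a i = ∑ i, l i → (supp a).card = m → ∃ b ∈ S, toLex b ≤ toLex a := by
    intro m
    induction m using Nat.strong_induction_on with
    | _ m ih =>
      intro a ha0 ha1 ha2 ham
      by_cases h : ∀ μ : ι → ℝ, IsAffineRelation v μ → (∀ i ∉ supp a, μ i = 0) → μ = 0
      · exact ⟨a, ⟨ha0, ha1, ha2, h⟩, le_rfl⟩
      · push Not at h
        obtain ⟨μ, hμ, hμs, hμ0⟩ := h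
        obtain ⟨μ', hμ', hμs', hneg⟩ : ∃ μ' : ι → ℝ, IsAffineRelation v μ' ∧
            (∀ i ∉ supp a, μ' i = 0) ∧ LexNeg μ' := by
          rcases lexNeg_or_lexNeg_neg hμ0 with h | h
          · exact ⟨μ, hμ, hμs, h⟩
          · exact ⟨-μ, hμ.neg, fun i hi => by simp [hμs i hi], h⟩
        obtain ⟨b, hb0, hb1, hb2, hlt, hcard⟩ := exists_lex_lt_card_supp_lt ha0 hμ' hμs' hneg
        obtain ⟨c, hc, hcb⟩ := ih _ (ham ▸ hcard) b hb0 (hb1.trans ha1) (hb2.trans ha2) rfl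
        exact ⟨c, hc, hcb.trans hlt.le⟩
  obtain ⟨b₀, hb₀, -⟩ := hdom _ l hl rfl rfl rfl
  obtain ⟨b, hb, hmin⟩ := Set.exists_min_image S toLex hfin ⟨b₀, hb₀⟩
  refine ⟨b, hb.1, hb.2.1, hb.2.2.1, fun μ hμ hμ0 hneg => ?_⟩
  -- a small positive multiple of `μ` keeps the coefficients nonnegative
  obtain ⟨ε, hε, hεb⟩ : ∃ ε : ℝ, 0 < ε ∧ ∀ i, 0 ≤ b i + ε * μ i := by
    have hev : ∀ᶠ ε : ℝ in nhdsWithin 0 (Set.Ioi 0), ∀ i, 0 ≤ b i + ε * μ i := by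
      rw [Filter.eventually_all]
      intro i
      by_cases hi : i ∈ supp b
      · have hpos : 0 < b i := lt_of_le_of_ne (hb.1 i) (Ne.symm (mem_supp.1 hi))
        have hc : Filter.Tendsto (fun ε : ℝ => b i + ε * μ i) (nhdsWithin 0 (Set.Ioi 0))
            (nhds (b i)) := by
          have : Continuous fun ε : ℝ => b i + ε * μ i := by fun_prop
          simpa using (this.tendsto 0).mono_left nhdsWithin_le_nhds
        filter_upwards [hc.eventually (lt_mem_nhds hpos)] with ε h using h.le
      · filter_upwards [self_mem_nhdsWithin] with ε h
        have h1 : (0 : ℝ) ≤ ε := le_of_lt h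
        have h2 := hμ0 i hi
        have h3 := hb.1 i
        positivity
    obtain ⟨ε, h1, h2⟩ := (hev.and self_mem_nhdsWithin).exists
    exact ⟨ε, h2, h1⟩
  obtain ⟨c, hc, hcb⟩ := hdom _ (b + ε • μ) hεb ((hμ.sum_add_smul b ε).trans hb.2.1)
    ((hμ.sum_add b ε).trans hb.2.2.1) rfl
  have h1 : toLex (b + ε • μ) < toLex b := by
    rw [← lexNeg_sub_iff]
    simpa using hneg.smul hε
  exact absurd (hmin c hc) (not_le.2 (hcb.trans_lt h1))

/-- A lexicographic face is affinely independent, so it has at most `dim + 1` elements. -/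
lemma IsLexFace.card_le {v : ι → E} [FiniteDimensional ℝ E] {σ : Finset ι}
    (h : IsLexFace v σ) :
    σ.card ≤ Module.finrank ℝ (vectorSpan ℝ (Set.range v)) + 1 := by
  classical
  have hind : AffineIndependent ℝ (fun i : σ => v i) := by
    rw [affineIndependent_iff_of_fintype]
    intro w hw0 hw i
    rw [Finset.univ.weightedVSub_eq_linear_combination hw0] at hw
    have hμ := h.eq_zero (μ := fun i => if hi : i ∈ σ then w ⟨i, hi⟩ else 0) ⟨?_, ?_⟩
      (fun i hi => by simp [hi])
    · have := congrFun hμ i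
      simpa using this
    · rw [← hw, ← Finset.sum_subset (Finset.subset_univ σ) (fun i _ hi => by simp [hi]),
        ← Finset.sum_coe_sort]
      exact Finset.sum_congr rfl fun i _ => by simp
    · refine Eq.trans ?_ hw0
      rw [← Finset.sum_subset (Finset.subset_univ σ) (fun i _ hi => by simp [hi]),
        ← Finset.sum_coe_sort]
      exact Finset.sum_congr rfl fun i _ => by simp
  have h1 := hind.card_le_finrank_succ
  rw [Fintype.card_coe] at h1
  have h2 : vectorSpan ℝ (Set.range fun i : σ => v i) ≤ vectorSpan ℝ (Set.range v) :=
    vectorSpan_mono ℝ (by rintro _ ⟨i, rfl⟩; exact ⟨i, rfl⟩)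
  have h3 := Submodule.finrank_mono h2
  omega

end Lex

/-! ### The integer lattice and dilates -/

section Basic

variable {n : ℕ}

/-- The integer lattice as an additive subgroup. -/
def latticeSubgroup (n : ℕ) : AddSubgroup (Fin n → ℝ) where
  carrier := integerLattice n
  zero_mem' := fun _ => ⟨0, by simp⟩
  add_mem' := fun {a b} ha hb i => by
    obtain ⟨k, hk⟩ := ha i
    obtain ⟨m, hm⟩ := hb i
    exact ⟨k + m, by simp [hk, hm]⟩
  neg_mem' := fun {a} ha i => by
    obtain ⟨k, hk⟩ := ha i
    exact ⟨-k, by simp [hk]⟩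

lemma natCast_smul_mem_integerLattice {x : Fin n → ℝ} (hx : x ∈ integerLattice n) (m : ℕ) :
    (m : ℝ) • x ∈ integerLattice n := by
  rw [Nat.cast_smul_eq_nsmul]
  exact (latticeSubgroup n).nsmul_mem hx m

lemma finite_inter_integerLattice {K : Set (Fin n → ℝ)} (hK : Bornology.IsBounded K) :
    (K ∩ integerLattice n).Finite := by
  obtain ⟨R, hR⟩ := hK.exists_norm_le
  refine ((Set.finite_Icc (fun _ : Fin n => -⌈R⌉) (fun _ : Fin n => ⌈R⌉)).image
    (fun m i => (m i : ℝ))).subset ?_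
  rintro x ⟨hxK, hx⟩
  choose m hm using hx
  refine ⟨m, ?_, (funext hm).symm⟩
  have hb : ∀ i, |(m i : ℝ)| ≤ R := fun i => by
    rw [← hm i]
    exact (norm_le_pi_norm x i).trans (hR x hxK)
  constructor
  · intro i
    have h1 : (-⌈R⌉ : ℝ) ≤ m i := by linarith [(abs_le.1 (hb i)).1, Int.le_ceil R]
    exact_mod_cast h1
  · intro i
    have h1 : (m i : ℝ) ≤ ⌈R⌉ := by linarith [(abs_le.1 (hb i)).2, Int.le_ceil R]
    exact_mod_cast h1

lemma mem_dilate {c : ℝ} {P : Set (Fin n → ℝ)} {x : Fin n → ℝ} :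
    x ∈ dilate c P ↔ ∃ p ∈ P, c • p = x := Iff.rfl

lemma dilate_zero {P : Set (Fin n → ℝ)} (h : P.Nonempty) : dilate 0 P = {0} := by
  ext x
  simp only [mem_dilate, zero_smul, Set.mem_singleton_iff]
  constructor
  · rintro ⟨_, _, h⟩
    exact h.symm
  · rintro rfl
    exact ⟨_, h.some_mem, rfl⟩

lemma isCompact_dilate {P : Set (Fin n → ℝ)} (h : IsCompact P) (c : ℝ) :
    IsCompact (dilate c P) :=
  h.image (continuous_const_smul c)

lemma IsPolytope.isCompact {P : Set (Fin n → ℝ)} (h : IsPolytope P) : IsCompact P := by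
  obtain ⟨s, rfl⟩ := h
  exact s.finite_toSet.isCompact_convexHull ℝ

lemma IsPolytope.convex {P : Set (Fin n → ℝ)} (h : IsPolytope P) : Convex ℝ P := by
  obtain ⟨s, rfl⟩ := h
  exact convex_convexHull ℝ _

lemma finite_dilate_inter {P : Set (Fin n → ℝ)} (h : IsCompact P) (c : ℝ) :
    (dilate c P ∩ integerLattice n).Finite :=
  finite_inter_integerLattice (isCompact_dilate h c).isBounded

/-- The convention `1` for the constant term of the Ehrhart series is the number of lattice points
of `0 P` if `P` is nonempty. -/
lemma coeff_ehr {P : Set (Fin n → ℝ)} (h : P.Nonempty) (k : ℕ) :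
    PowerSeries.coeff k (ehr P) = ((dilate (k : ℝ) P ∩ integerLattice n).ncard : ℚ) := by
  rw [ehr, PowerSeries.coeff_mk]
  split_ifs with hk
  · subst hk
    have : ({0} : Set (Fin n → ℝ)) ∩ integerLattice n = {0} :=
      Set.inter_eq_left.2 (Set.singleton_subset_iff.2 (latticeSubgroup n).zero_mem)
    rw [Nat.cast_zero, dilate_zero h, this, Set.ncard_singleton, Nat.cast_one]
  · rfl

lemma mem_convexHull_range_iff {ι E : Type*} [Fintype ι] [AddCommGroup E] [Module ℝ E]
    (v : ι → E) (x : E) : x ∈ convexHull ℝ (Set.range v) ↔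
      ∃ l : ι → ℝ, (∀ i, 0 ≤ l i) ∧ ∑ i, l i = 1 ∧ ∑ i, l i • v i = x := by
  classical
  constructor
  · intro hx
    let S : Set E := {y | ∃ l : ι → ℝ, (∀ i, 0 ≤ l i) ∧ ∑ i, l i = 1 ∧ ∑ i, l i • v i = y}
    have hS : Convex ℝ S := by
      rintro _ ⟨l, h1, h2, rfl⟩ _ ⟨l', h1', h2', rfl⟩ a b ha hb hab
      refine ⟨fun i => a * l i + b * l' i, fun i => ?_, ?_, ?_⟩
      · have := h1 i
        have := h1' i
        positivity
      · simp [Finset.sum_add_distrib, ← Finset.mul_sum, h2, h2', hab]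
      · simp [add_smul, Finset.sum_add_distrib, mul_smul, Finset.smul_sum]
    refine convexHull_min (t := S) ?_ hS hx
    rintro _ ⟨i, rfl⟩
    refine ⟨Pi.single i 1, fun j => ?_, by simp, ?_⟩
    · by_cases h : j = i
      · subst h; simp
      · simp [h]
    · simp [Pi.single_apply, ite_smul]
  · rintro ⟨l, h1, h2, rfl⟩
    exact (convex_convexHull ℝ _).sum_mem (fun i _ => h1 i) h2
      fun i _ => subset_convexHull ℝ _ ⟨i, rfl⟩

lemma mem_dilate_convexHull_range {ι : Type*} [Fintype ι] [Nonempty ι] (v : ι → Fin n → ℝ)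
    {c : ℝ} (hc : 0 ≤ c) (x : Fin n → ℝ) : x ∈ dilate c (convexHull ℝ (Set.range v)) ↔
      ∃ l : ι → ℝ, (∀ i, 0 ≤ l i) ∧ ∑ i, l i = c ∧ ∑ i, l i • v i = x := by
  constructor
  · rintro ⟨p, hp, rfl⟩
    obtain ⟨l, h1, h2, rfl⟩ := (mem_convexHull_range_iff v p).1 hp
    refine ⟨fun i => c * l i, fun i => mul_nonneg hc (h1 i), ?_, ?_⟩
    · rw [← Finset.mul_sum, h2, mul_one]
    · simp [mul_smul, Finset.smul_sum]
  · rintro ⟨l, h1, h2, rfl⟩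
    rcases hc.eq_or_lt with rfl | hc
    · have h0 : ∀ i, l i = 0 := fun i =>
        (Finset.sum_eq_zero_iff_of_nonneg fun i _ => h1 i).1 h2 i (Finset.mem_univ i)
      rw [dilate_zero (Set.range_nonempty v).convexHull]
      simp [h0]
    · refine ⟨∑ i, (c⁻¹ * l i) • v i, (mem_convexHull_range_iff v _).2
        ⟨_, fun i => mul_nonneg (inv_nonneg.2 hc.le) (h1 i), ?_, rfl⟩, ?_⟩
      · rw [← Finset.mul_sum, h2, inv_mul_cancel₀ hc.ne']
      · simp only [Finset.smul_sum, smul_smul]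
        exact Finset.sum_congr rfl fun i _ => by rw [mul_inv_cancel_left₀ hc.ne']

end Basic

/-! ### Ehrhart's theorem -/

section Ehrhart

variable {n : ℕ} {ι : Type*} [Fintype ι]

/-- The coefficient vectors with support `σ` of the lattice points at height `k` in the open
simplicial cone over the points `(v i, 1)`, `i ∈ σ`, such that the coefficients at the elements of
`τ` are at most `D`. -/
def coneCoeffs (v : ι → Fin n → ℝ) (D : ℕ) (σ τ : Finset ι) (k : ℕ) : Set (ι → ℝ) :=
  {l | (∀ i ∈ σ, 0 < l i) ∧ (∀ i ∉ σ, l i = 0) ∧ (∀ i ∈ τ, l i ≤ D) ∧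
    ∑ i, l i • v i ∈ integerLattice n ∧ ∑ i, l i = k}

/-- The generating function of `coneCoeffs`. -/
noncomputable def coneSeries (v : ι → Fin n → ℝ) (D : ℕ) (σ τ : Finset ι) : PowerSeries ℚ :=
  PowerSeries.mk fun k => ((coneCoeffs v D σ τ k).ncard : ℚ)

lemma nonneg_of_mem_coneCoeffs {v : ι → Fin n → ℝ} {D : ℕ} {σ τ : Finset ι} {k : ℕ} {l : ι → ℝ}
    (h : l ∈ coneCoeffs v D σ τ k) (i : ι) : 0 ≤ l i := by
  by_cases hi : i ∈ σ
  · exact (h.1 i hi).le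
  · exact (h.2.1 i hi).ge

lemma supp_of_mem_coneCoeffs {v : ι → Fin n → ℝ} {D : ℕ} {σ τ : Finset ι} {k : ℕ} {l : ι → ℝ}
    (h : l ∈ coneCoeffs v D σ τ k) : supp l = σ := by
  ext i
  rw [mem_supp]
  by_cases hi : i ∈ σ
  · simp [hi, (h.1 i hi).ne']
  · simp [hi, h.2.1 i hi]

/-- Replacing the coefficient bound at one more index multiplies the generating function by
`1 - X ^ D`: the coefficient vectors violating the new bound are a translate of all of them. -/
lemma coneSeries_insert [DecidableEq ι] {v : ι → Fin n → ℝ} {D : ℕ}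
    (hv : ∀ i, (D : ℝ) • v i ∈ integerLattice n) {σ τ : Finset ι} {i : ι} (hi : i ∈ σ)
    (hiτ : i ∉ τ) (hfin : ∀ k, (coneCoeffs v D σ τ k).Finite) :
    coneSeries v D σ (insert i τ) = (1 - PowerSeries.X ^ D) * coneSeries v D σ τ := by
  have hsub : ∀ k, coneCoeffs v D σ (insert i τ) k ⊆ coneCoeffs v D σ τ k :=
    fun k l hl => ⟨hl.1, hl.2.1, fun j hj => hl.2.2.1 j (Finset.mem_insert_of_mem hj), hl.2.2.2⟩
  have hshift : ∀ (l : ι → ℝ) (s : ℝ),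
      ∑ j, (l + Pi.single i s : ι → ℝ) j • v j = ∑ j, l j • v j + s • v i := fun l s => by
    simp [add_smul, Finset.sum_add_distrib, Pi.single_apply, ite_smul]
  have hsum : ∀ (l : ι → ℝ) (s : ℝ), ∑ j, (l + Pi.single i s : ι → ℝ) j = ∑ j, l j + s :=
    fun l s => by simp [Finset.sum_add_distrib]
  ext k
  rw [sub_mul, one_mul, map_sub, PowerSeries.coeff_X_pow_mul']
  simp only [coneSeries, PowerSeries.coeff_mk]
  split_ifs with hk
  · have hdiff : coneCoeffs v D σ τ k \ coneCoeffs v D σ (insert i τ) k =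
        (fun l : ι → ℝ => l + Pi.single i (D : ℝ)) '' coneCoeffs v D σ τ (k - D) := by
      ext l
      constructor
      · rintro ⟨⟨h1, h2, h3, h4, h5⟩, hl⟩
        have hlt : (D : ℝ) < l i := by
          by_contra hle
          refine hl ⟨h1, h2, fun j hj => ?_, h4, h5⟩
          rcases Finset.mem_insert.1 hj with rfl | hj
          · exact not_lt.1 hle
          · exact h3 j hj
        refine ⟨l + Pi.single i (-(D : ℝ)), ⟨fun j hj => ?_, fun j hj => ?_, fun j hj => ?_, ?_,
          ?_⟩, ?_⟩
        · by_cases hji : j = i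
          · subst hji; simpa using hlt
          · simpa [hji] using h1 j hj
        · have hji : j ≠ i := fun h => hj (h ▸ hi)
          simpa [hji] using h2 j hj
        · have hji : j ≠ i := fun h => hiτ (h ▸ hj)
          simpa [hji] using h3 j hj
        · rw [hshift, neg_smul, ← sub_eq_add_neg]
          exact (latticeSubgroup n).sub_mem h4 (hv i)
        · rw [hsum, h5, Nat.cast_sub hk, sub_eq_add_neg]
        · ext j
          by_cases hji : j = i
          · subst hji; simp
          · simp [hji]
      · rintro ⟨l, ⟨h1, h2, h3, h4, h5⟩, rfl⟩
        refine ⟨⟨fun j hj => ?_, fun j hj => ?_, fun j hj => ?_, ?_, ?_⟩, fun hl => ?_⟩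
        · by_cases hji : j = i
          · subst hji
            have := h1 j hj
            simp only [Pi.add_apply, Pi.single_eq_same]
            positivity
          · simpa [hji] using h1 j hj
        · have hji : j ≠ i := fun h => hj (h ▸ hi)
          simpa [hji] using h2 j hj
        · have hji : j ≠ i := fun h => hiτ (h ▸ hj)
          simpa [hji] using h3 j hj
        · simp only [hshift]
          exact (latticeSubgroup n).add_mem h4 (hv i)
        · simp only [hsum]
          rw [h5, Nat.cast_sub hk, sub_add_cancel]
        · have := hl.2.2.1 i (Finset.mem_insert_self i τ)
          have h6 := h1 i hi
          simp only [Pi.add_apply, Pi.single_eq_same] at this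
          linarith
    have hcard := Set.ncard_sdiff_add_ncard_of_subset (hsub k) (hfin k)
    rw [hdiff, Set.ncard_image_of_injective _ (add_left_injective _)] at hcard
    rw [← hcard]
    push_cast
    ring
  · have : coneCoeffs v D σ (insert i τ) k = coneCoeffs v D σ τ k := by
      refine (hsub k).antisymm fun l hl => ⟨hl.1, hl.2.1, fun j hj => ?_, hl.2.2.2⟩
      have h1 : l j ≤ ∑ i, l i :=
        Finset.single_le_sum (fun i _ => nonneg_of_mem_coneCoeffs hl i) (Finset.mem_univ j)
      rw [hl.2.2.2.2] at h1
      have h2 : (k : ℝ) ≤ D := by exact_mod_cast (not_le.1 hk).le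
      exact h1.trans h2
    rw [this, sub_zero]

lemma exists_polynomial_of_coeff_eq_zero {f : PowerSeries ℚ} {N : ℕ}
    (h : ∀ k, N ≤ k → PowerSeries.coeff k f = 0) : ∃ g : Polynomial ℚ, f = g := by
  refine ⟨PowerSeries.trunc N f, ?_⟩
  ext k
  rw [Polynomial.coeff_coe, PowerSeries.coeff_trunc]
  split_ifs with hk
  · rfl
  · exact h k (not_lt.1 hk)

/-- The generating function of an open simplicial cone is a polynomial divided by a power of
`1 - X ^ D`. -/
lemma exists_polynomial_coneSeries {v : ι → Fin n → ℝ} {D : ℕ}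
    (hv : ∀ i, (D : ℝ) • v i ∈ integerLattice n) {σ : Finset ι}
    (hfin : ∀ k, (coneCoeffs v D σ ∅ k).Finite) :
    ∃ g : Polynomial ℚ, (1 - PowerSeries.X ^ D) ^ σ.card * coneSeries v D σ ∅ =
      (g : PowerSeries ℚ) := by
  classical
  have hfin' : ∀ τ k, (coneCoeffs v D σ τ k).Finite := fun τ k =>
    (hfin k).subset fun l hl => ⟨hl.1, hl.2.1, fun j hj => absurd hj (Finset.notMem_empty j),
      hl.2.2.2⟩
  have key : ∀ τ : Finset ι, τ ⊆ σ →
      coneSeries v D σ τ = (1 - PowerSeries.X ^ D) ^ τ.card * coneSeries v D σ ∅ := by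
    intro τ
    induction τ using Finset.induction_on with
    | empty => simp
    | insert i τ hi ih =>
      intro h
      rw [coneSeries_insert hv (h (Finset.mem_insert_self i τ)) hi (hfin' τ),
        ih ((Finset.subset_insert i τ).trans h), Finset.card_insert_of_notMem hi, pow_succ']
      ring
  rw [← key σ subset_rfl]
  refine exists_polynomial_of_coeff_eq_zero (N := D * σ.card + 1) fun k hk => ?_
  have : coneCoeffs v D σ σ k = ∅ := by
    refine Set.eq_empty_of_forall_notMem fun l hl => ?_
    have h1 : ∑ i, l i ≤ D * σ.card := by
      rw [← Finset.sum_subset (Finset.subset_univ σ) fun i _ hi => hl.2.1 i hi]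
      calc ∑ i ∈ σ, l i ≤ ∑ i ∈ σ, (D : ℝ) := Finset.sum_le_sum fun i hi => hl.2.2.1 i hi
        _ = D * σ.card := by simp [mul_comm]
    rw [hl.2.2.2.2] at h1
    have h2 : k ≤ D * σ.card := by exact_mod_cast h1
    omega
  simp [coneSeries, this]

/-- Every lattice point of `k P` has exactly one representation supported on a lexicographic
face. -/
lemma ncard_dilate_eq_sum [LinearOrder ι] [Nonempty ι] (v : ι → Fin n → ℝ) (D : ℕ)
    (S : Finset (Finset ι)) (hS : ∀ σ, σ ∈ S ↔ IsLexFace v σ) (k : ℕ) :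
    (∀ σ ∈ S, (coneCoeffs v D σ ∅ k).Finite) ∧
    (dilate (k : ℝ) (convexHull ℝ (Set.range v)) ∩ integerLattice n).ncard =
      ∑ σ ∈ S, (coneCoeffs v D σ ∅ k).ncard := by
  have hfin : (dilate (k : ℝ) (convexHull ℝ (Set.range v)) ∩ integerLattice n).Finite :=
    finite_dilate_inter ((Set.finite_range v).isCompact_convexHull ℝ) k
  have hinj : Set.InjOn (fun l : ι → ℝ => ∑ i, l i • v i) (⋃ σ ∈ S, coneCoeffs v D σ ∅ k) := by
    intro a ha b hb hab
    simp only [Set.mem_iUnion] at ha hb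
    obtain ⟨σ, hσ, ha⟩ := ha
    obtain ⟨σ', hσ', hb⟩ := hb
    refine IsLexFace.unique (v := v) ?_ ?_ (nonneg_of_mem_coneCoeffs ha)
      (nonneg_of_mem_coneCoeffs hb) hab (ha.2.2.2.2.trans hb.2.2.2.2.symm)
    · rw [supp_of_mem_coneCoeffs ha]
      exact (hS σ).1 hσ
    · rw [supp_of_mem_coneCoeffs hb]
      exact (hS σ').1 hσ'
  have himage : (fun l : ι → ℝ => ∑ i, l i • v i) '' (⋃ σ ∈ S, coneCoeffs v D σ ∅ k) =
      dilate (k : ℝ) (convexHull ℝ (Set.range v)) ∩ integerLattice n := by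
    ext x
    constructor
    · rintro ⟨l, hl, rfl⟩
      simp only [Set.mem_iUnion] at hl
      obtain ⟨σ, hσ, hl⟩ := hl
      exact ⟨(mem_dilate_convexHull_range v (Nat.cast_nonneg k) _).2
        ⟨l, nonneg_of_mem_coneCoeffs hl, hl.2.2.2.2, rfl⟩, hl.2.2.2.1⟩
    · rintro ⟨hx, hxL⟩
      obtain ⟨l, h1, h2, rfl⟩ := (mem_dilate_convexHull_range v (Nat.cast_nonneg k) _).1 hx
      obtain ⟨l', h1', h2', h3', h4'⟩ := exists_isLexFace_supp v h1
      refine ⟨l', ?_, h2'⟩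
      simp only [Set.mem_iUnion]
      refine ⟨supp l', (hS _).2 h4', fun i hi => ?_, fun i hi => by simpa using hi, by simp, ?_,
        h3'.trans h2⟩
      · exact lt_of_le_of_ne (h1' i) (Ne.symm (mem_supp.1 hi))
      · rw [h2']
        exact hxL
  have hfinU : (⋃ σ ∈ S, coneCoeffs v D σ ∅ k).Finite :=
    Set.Finite.of_finite_image (himage ▸ hfin) hinj
  have hfinσ : ∀ σ ∈ S, (coneCoeffs v D σ ∅ k).Finite := fun σ hσ =>
    hfinU.subset (Set.subset_biUnion_of_mem (u := fun σ => coneCoeffs v D σ ∅ k) hσ)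
  refine ⟨hfinσ, ?_⟩
  rw [← himage, hinj.ncard_image]
  have h := Set.Finite.ncard_biUnion (t := (S : Set (Finset ι))) S.finite_toSet
    (s := fun σ => coneCoeffs v D σ ∅ k) hfinσ ?_
  · rw [finsum_mem_coe_finset] at h
    exact h
  · intro σ _ σ' _ hne
    refine Set.disjoint_left.2 fun l hl hl' => hne ?_
    rw [← supp_of_mem_coneCoeffs hl, supp_of_mem_coneCoeffs hl']

/-- Ehrhart's theorem for the convex hull of points `v i` with `D v i` integral. -/
theorem exists_polynomial_ehr_convexHull_range [LinearOrder ι] [Nonempty ι] (v : ι → Fin n → ℝ)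
    {D : ℕ} (hv : ∀ i, (D : ℝ) • v i ∈ integerLattice n) :
    ∃ f : Polynomial ℚ, ehr (convexHull ℝ (Set.range v)) *
      (1 - PowerSeries.X ^ D) ^ (dim (convexHull ℝ (Set.range v)) + 1) =
        (f : PowerSeries ℚ) := by
  classical
  let S : Finset (Finset ι) := {σ | IsLexFace v σ}
  have hS : ∀ σ, σ ∈ S ↔ IsLexFace v σ := fun σ => by simp [S]
  have hdim : dim (convexHull ℝ (Set.range v)) =
      Module.finrank ℝ (vectorSpan ℝ (Set.range v)) := by
    rw [dim, ← direction_affineSpan, affineSpan_convexHull, direction_affineSpan]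
  have hehr : ehr (convexHull ℝ (Set.range v)) = ∑ σ ∈ S, coneSeries v D σ ∅ := by
    ext k
    rw [coeff_ehr (Set.range_nonempty v).convexHull, (ncard_dilate_eq_sum v D S hS k).2, map_sum]
    simp [coneSeries]
  have hpoly : ∀ σ ∈ S, ∃ g : Polynomial ℚ, coneSeries v D σ ∅ *
      (1 - PowerSeries.X ^ D) ^ (dim (convexHull ℝ (Set.range v)) + 1) =
        (g : PowerSeries ℚ) := by
    intro σ hσ
    obtain ⟨g, hg⟩ := exists_polynomial_coneSeries hv
      fun k => (ncard_dilate_eq_sum v D S hS k).1 σ hσ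
    have hle : σ.card ≤ dim (convexHull ℝ (Set.range v)) + 1 := by
      rw [hdim]
      exact ((hS σ).1 hσ).card_le
    obtain ⟨m, hm⟩ := Nat.exists_eq_add_of_le hle
    refine ⟨g * (1 - Polynomial.X ^ D) ^ m, ?_⟩
    push_cast
    rw [hm, pow_add, ← hg]
    ring
  choose! g hg using hpoly
  refine ⟨∑ σ ∈ S, g σ, ?_⟩
  rw [hehr, Finset.sum_mul, Finset.sum_congr rfl hg]
  exact (map_sum (Polynomial.coeToPowerSeries.ringHom (R := ℚ)) g S).symm

end Ehrhart

/-! ### Vertices and denominators -/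

section Vertices

variable {n : ℕ} {P : Set (Fin n → ℝ)}

lemma IsPolytope.finite_extremePoints (h : IsPolytope P) : (P.extremePoints ℝ).Finite := by
  obtain ⟨s, rfl⟩ := h
  exact s.finite_toSet.subset extremePoints_convexHull_subset

lemma IsPolytope.convexHull_extremePoints (h : IsPolytope P) :
    convexHull ℝ (P.extremePoints ℝ) = P := by
  conv_rhs => rw [← closure_convexHull_extremePoints h.isCompact h.convex]
  exact (h.finite_extremePoints.isClosed_convexHull ℝ).closure_eq.symm

lemma IsPolytope.exists_range_eq (h : IsPolytope P) :
    ∃ (m : ℕ) (v : Fin m → Fin n → ℝ), Set.range v = P.extremePoints ℝ := by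
  obtain ⟨m, v, hv⟩ := h.finite_extremePoints.fin_embedding
  exact ⟨m, v, hv⟩

lemma IsPolytope.dilate (h : IsPolytope P) (c : ℝ) : IsPolytope (dilate c P) := by
  classical
  obtain ⟨s, rfl⟩ := h
  refine ⟨s.image fun x => c • x, ?_⟩
  have := (LinearMap.lsmul ℝ (Fin n → ℝ) c).image_convexHull (s : Set (Fin n → ℝ))
  rw [Finset.coe_image]
  exact this

lemma extremePoints_dilate {c : ℝ} (hc : c ≠ 0) :
    (dilate c P).extremePoints ℝ = (fun x => c • x) '' P.extremePoints ℝ :=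
  (image_extremePoints (LinearEquiv.smulOfNeZero ℝ (Fin n → ℝ) c hc) P).symm

/-- The dilate `k P` of a polytope is a lattice polytope if and only if `k v` is integral for all
vertices `v` of `P`. -/
lemma IsPolytope.isLatticePolytope_dilate_iff (h : IsPolytope P) {k : ℕ} (hk : 0 < k) :
    IsLatticePolytope (Ehrhart.dilate (k : ℝ) P) ↔
      ∀ v ∈ P.extremePoints ℝ, (k : ℝ) • v ∈ integerLattice n := by
  have hk0 : (k : ℝ) ≠ 0 := by exact_mod_cast hk.ne'
  rw [IsLatticePolytope, extremePoints_dilate hk0, Set.forall_mem_image]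
  exact and_iff_right (h.dilate _)

lemma IsRationalPolytope.exists_isLatticePolytope (h : IsRationalPolytope P) :
    ∃ k : ℕ, 0 < k ∧ IsLatticePolytope (Ehrhart.dilate (k : ℝ) P) := by
  obtain ⟨m, v, hv⟩ := h.1.exists_range_eq
  have hq : ∀ j i, ∃ q : ℚ, v j i = q := fun j i => h.2 (v j) (hv ▸ ⟨j, rfl⟩) i
  choose q hq using hq
  have hk : 0 < ∏ j, ∏ i, (q j i).den :=
    Finset.prod_pos fun j _ => Finset.prod_pos fun i _ => (q j i).den_pos
  refine ⟨∏ j, ∏ i, (q j i).den, hk, (h.1.isLatticePolytope_dilate_iff hk).2 ?_⟩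
  rw [← hv]
  rintro _ ⟨j, rfl⟩ i
  have hdvd : (q j i).den ∣ ∏ j, ∏ i, (q j i).den :=
    (Finset.dvd_prod_of_mem _ (Finset.mem_univ i)).trans
      (Finset.dvd_prod_of_mem (fun j => ∏ i, (q j i).den) (Finset.mem_univ j))
  obtain ⟨c, hc⟩ := hdvd
  refine ⟨c * (q j i).num, ?_⟩
  have h1 : ((q j i).den : ℝ) * (q j i : ℝ) = (q j i).num := by
    exact_mod_cast Rat.den_mul_eq_num (q j i)
  rw [hc, Pi.smul_apply, smul_eq_mul, hq]
  push_cast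
  rw [← h1]
  ring

lemma IsRationalPolytope.den_pos (h : IsRationalPolytope P) : 0 < den P :=
  (Nat.sInf_mem h.exists_isLatticePolytope).1

lemma IsRationalPolytope.den_smul_mem (h : IsRationalPolytope P) {v : Fin n → ℝ}
    (hv : v ∈ P.extremePoints ℝ) : (den P : ℝ) • v ∈ integerLattice n :=
  (h.1.isLatticePolytope_dilate_iff h.den_pos).1 (Nat.sInf_mem h.exists_isLatticePolytope).2 v hv

lemma IsRationalPolytope.den_dvd_iff (h : IsRationalPolytope P) (k : ℕ) :
    den P ∣ k ↔ ∀ v ∈ P.extremePoints ℝ, (k : ℝ) • v ∈ integerLattice n := by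
  constructor
  · rintro ⟨c, rfl⟩ v hv
    rw [mul_comm, Nat.cast_mul, mul_smul]
    exact natCast_smul_mem_integerLattice (h.den_smul_mem hv) c
  · intro hk
    rw [Nat.dvd_iff_mod_eq_zero]
    by_contra hne
    have hpos : 0 < k % den P := Nat.pos_of_ne_zero hne
    have hmem : k % den P ∈ {k : ℕ | 0 < k ∧ IsLatticePolytope (Ehrhart.dilate (k : ℝ) P)} := by
      refine ⟨hpos, (h.1.isLatticePolytope_dilate_iff hpos).2 fun v hv => ?_⟩
      have h1 : ((k % den P : ℕ) : ℝ) • v =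
          (k : ℝ) • v - ((k / den P : ℕ) : ℝ) • (den P : ℝ) • v := by
        rw [smul_smul, ← sub_smul]
        congr 1
        have : ((den P * (k / den P) + k % den P : ℕ) : ℝ) = k := by rw [Nat.div_add_mod]
        push_cast at this
        linarith
      rw [h1]
      exact (latticeSubgroup n).sub_mem (hk v hv)
        (natCast_smul_mem_integerLattice (h.den_smul_mem hv) _)
    exact absurd (Nat.sInf_le hmem) (not_le.2 (Nat.mod_lt _ h.den_pos))

lemma IsLatticePolytope.den_eq_one (h : IsLatticePolytope P) : den P = 1 := by
  have h1 : IsLatticePolytope (Ehrhart.dilate ((1 : ℕ) : ℝ) P) :=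
    (h.1.isLatticePolytope_dilate_iff one_pos).2 fun v hv => by simpa using h.2 v hv
  have hmem : 1 ∈ {k : ℕ | 0 < k ∧ IsLatticePolytope (Ehrhart.dilate (k : ℝ) P)} :=
    ⟨one_pos, h1⟩
  exact le_antisymm (Nat.sInf_le hmem) (Nat.sInf_mem ⟨1, hmem⟩).1

/-- By Ehrhart's theorem, the `δ`-polynomial of a nonempty rational polytope has its defining
property. -/
theorem IsRationalPolytope.coe_delta (h : IsRationalPolytope P) (hne : P.Nonempty) :
    (delta P : PowerSeries ℚ) = ehr P * (1 - PowerSeries.X ^ den P) ^ (dim P + 1) := by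
  obtain ⟨m, v, hv⟩ := h.1.exists_range_eq
  have hP : convexHull ℝ (Set.range v) = P := by rw [hv, h.1.convexHull_extremePoints]
  have hm : Nonempty (Fin m) := by
    by_contra hm
    rw [not_nonempty_iff] at hm
    rw [← hP, Set.range_eq_empty, convexHull_empty] at hne
    exact Set.not_nonempty_empty hne
  have hex := exists_polynomial_ehr_convexHull_range v (D := den P)
    fun i => h.den_smul_mem (hv ▸ ⟨i, rfl⟩)
  rw [hP] at hex
  rw [delta, dif_pos hex]
  exact hex.choose_spec.symm

end Vertices

/-! ### Free sums -/

section FreeSum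

variable {n : ℕ} {P Q : Set (Fin n → ℝ)}

lemma dilate_mono (hP : Convex ℝ P) (h0 : (0 : Fin n → ℝ) ∈ P) {a b : ℝ} (ha : 0 ≤ a)
    (hab : a ≤ b) : dilate a P ⊆ dilate b P := by
  rintro _ ⟨p, hp, rfl⟩
  rcases ha.eq_or_lt with rfl | ha
  · exact ⟨0, h0, by simp⟩
  · have hb : 0 < b := ha.trans_le hab
    refine ⟨(a / b) • p, hP.smul_mem_of_zero_mem h0 hp ⟨by positivity, (div_le_one hb).2 hab⟩, ?_⟩
    simp only [smul_smul]
    rw [mul_div_cancel₀ _ hb.ne']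

lemma dilate_subset_span (c : ℝ) : dilate c P ⊆ Submodule.span ℝ P := by
  rintro _ ⟨p, hp, rfl⟩
  exact Submodule.smul_mem _ _ (Submodule.subset_span hp)

lemma smul_mem_dilate {a : ℝ} {x : Fin n → ℝ} (hx : x ∈ dilate a P) (c : ℝ) :
    c • x ∈ dilate (c * a) P := by
  obtain ⟨p, hp, rfl⟩ := hx
  exact ⟨p, hp, mul_smul _ _ _⟩

lemma mem_oplus (hP : Convex ℝ P) (hQ : Convex ℝ Q) (hP0 : P.Nonempty) (hQ0 : Q.Nonempty)
    {z : Fin n → ℝ} : z ∈ oplus P Q ↔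
      ∃ p ∈ P, ∃ q ∈ Q, ∃ a b : ℝ, 0 ≤ a ∧ 0 ≤ b ∧ a + b = 1 ∧ a • p + b • q = z := by
  rw [oplus, hP.convexHull_union hQ hP0 hQ0, mem_convexJoin]
  rfl

/-- The dilates of `P ⊕ Q` are unions of sums of dilates of `P` and `Q`. -/
lemma mem_dilate_oplus (hP : Convex ℝ P) (hQ : Convex ℝ Q) (hP0 : P.Nonempty) (hQ0 : Q.Nonempty)
    {c : ℝ} (hc : 0 ≤ c) {z : Fin n → ℝ} : z ∈ dilate c (oplus P Q) ↔
      ∃ a b : ℝ, 0 ≤ a ∧ 0 ≤ b ∧ a + b = c ∧ ∃ x ∈ dilate a P, ∃ y ∈ dilate b Q, x + y = z := by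
  constructor
  · rintro ⟨w, hw, rfl⟩
    obtain ⟨p, hp, q, hq, a, b, ha, hb, hab, rfl⟩ := (mem_oplus hP hQ hP0 hQ0).1 hw
    refine ⟨c * a, c * b, by positivity, by positivity, by rw [← mul_add, hab, mul_one],
      (c * a) • p, ⟨p, hp, rfl⟩, (c * b) • q, ⟨q, hq, rfl⟩, ?_⟩
    simp [smul_add, mul_smul]
  · rintro ⟨a, b, ha, hb, hab, _, ⟨p, hp, rfl⟩, _, ⟨q, hq, rfl⟩, rfl⟩
    rcases hc.eq_or_lt with rfl | hc
    · have ha0 : a = 0 := by linarith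
      have hb0 : b = 0 := by linarith
      exact ⟨p, subset_convexHull ℝ _ (Or.inl hp), by simp [ha0, hb0]⟩
    · refine ⟨(a / c) • p + (b / c) • q, (mem_oplus hP hQ hP0 hQ0).2
        ⟨p, hp, q, hq, a / c, b / c, by positivity, by positivity, ?_, rfl⟩, ?_⟩
      · rw [← add_div, hab, div_self hc.ne']
      · simp only [smul_add, smul_smul]
        rw [mul_div_cancel₀ _ hc.ne', mul_div_cancel₀ _ hc.ne']

lemma zero_mem_oplus (h0 : (0 : Fin n → ℝ) ∈ P) : (0 : Fin n → ℝ) ∈ oplus P Q :=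
  subset_convexHull ℝ _ (Or.inl h0)

lemma span_convexHull_eq (s : Set (Fin n → ℝ)) :
    Submodule.span ℝ (convexHull ℝ s) = Submodule.span ℝ s :=
  le_antisymm (Submodule.span_le.2 (convexHull_min Submodule.subset_span
    (Submodule.span ℝ s).convex)) (Submodule.span_mono (subset_convexHull ℝ s))

lemma dim_eq_finrank_span (h0 : (0 : Fin n → ℝ) ∈ P) :
    dim P = Module.finrank ℝ (Submodule.span ℝ P) := by
  rw [dim, vectorSpan_eq_span_vsub_set_right ℝ h0]
  have : (fun x : Fin n → ℝ => x -ᵥ (0 : Fin n → ℝ)) '' P = P := by simp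
  rw [this]

lemma eq_of_add_eq_add {p q p' q' : Fin n → ℝ}
    (h : Disjoint (Submodule.span ℝ P) (Submodule.span ℝ Q))
    (hp : p ∈ Submodule.span ℝ P) (hp' : p' ∈ Submodule.span ℝ P)
    (hq : q ∈ Submodule.span ℝ Q) (hq' : q' ∈ Submodule.span ℝ Q) (heq : p + q = p' + q') :
    p = p' ∧ q = q' := by
  have h1 : p - p' = q' - q := by
    rw [sub_eq_sub_iff_add_eq_add, heq, add_comm]
  have h2 : p - p' = 0 := Submodule.disjoint_def.1 h _ (Submodule.sub_mem _ hp hp')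
    (h1 ▸ Submodule.sub_mem _ hq' hq)
  have h3 : p = p' := sub_eq_zero.1 h2
  exact ⟨h3, by simpa [h3] using heq⟩

lemma dim_oplus (hP0 : (0 : Fin n → ℝ) ∈ P) (hQ0 : (0 : Fin n → ℝ) ∈ Q)
    (h : Disjoint (Submodule.span ℝ P) (Submodule.span ℝ Q)) :
    dim (oplus P Q) = dim P + dim Q := by
  rw [dim_eq_finrank_span (zero_mem_oplus hP0), dim_eq_finrank_span hP0, dim_eq_finrank_span hQ0,
    oplus, span_convexHull_eq, Submodule.span_union]
  have := Submodule.finrank_sup_add_finrank_inf_eq (Submodule.span ℝ P) (Submodule.span ℝ Q)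
  rw [h.eq_bot, finrank_bot, add_zero] at this
  exact this

lemma IsPolytope.oplus (hP : IsPolytope P) (hQ : IsPolytope Q) : IsPolytope (oplus P Q) := by
  classical
  obtain ⟨s, rfl⟩ := hP
  obtain ⟨t, rfl⟩ := hQ
  refine ⟨s ∪ t, ?_⟩
  rw [Ehrhart.oplus, convexHull_convexHull_union_left, convexHull_convexHull_union_right,
    Finset.coe_union]

lemma extremePoints_oplus_subset :
    (oplus P Q).extremePoints ℝ ⊆ P.extremePoints ℝ ∪ Q.extremePoints ℝ := by
  intro v hv
  rcases extremePoints_convexHull_subset hv with h | h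
  · exact Or.inl (inter_extremePoints_subset_extremePoints_of_subset
      (Set.subset_union_left.trans (subset_convexHull ℝ _)) ⟨h, hv⟩)
  · exact Or.inr (inter_extremePoints_subset_extremePoints_of_subset
      (Set.subset_union_right.trans (subset_convexHull ℝ _)) ⟨h, hv⟩)

lemma oplus_comm : oplus P Q = oplus Q P := by rw [oplus, oplus, Set.union_comm]

lemma IsRationalPolytope.oplus (hP : IsRationalPolytope P) (hQ : IsRationalPolytope Q) :
    IsRationalPolytope (oplus P Q) := by
  refine ⟨hP.1.oplus hQ.1, fun v hv => ?_⟩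
  rcases extremePoints_oplus_subset hv with h | h
  · exact hP.2 v h
  · exact hQ.2 v h

/-- Apart from the origin, the vertices of `P` are vertices of the free sum `P ⊕ Q`. -/
lemma extremePoints_subset_insert (hP : IsPolytope P) (hQ : IsPolytope Q)
    (hP0 : (0 : Fin n → ℝ) ∈ P)
    (h : Disjoint (Submodule.span ℝ P) (Submodule.span ℝ Q)) :
    P.extremePoints ℝ ⊆ insert 0 ((oplus P Q).extremePoints ℝ) := by
  set W := (oplus P Q).extremePoints ℝ with hW
  -- `P` is the convex hull of the origin and the vertices of `P ⊕ Q` that lie in `P`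
  have hsub : P ⊆ convexHull ℝ (insert 0 (W ∩ P)) := by
    intro p hp
    have hA : (insert 0 (W ∩ P) : Set (Fin n → ℝ)) ⊆ Submodule.span ℝ P :=
      Set.insert_subset (Submodule.zero_mem _) fun w hw => Submodule.subset_span hw.2
    have hB : (insert 0 (W ∩ Q) : Set (Fin n → ℝ)) ⊆ Submodule.span ℝ Q :=
      Set.insert_subset (Submodule.zero_mem _) fun w hw => Submodule.subset_span hw.2
    have hsplit : W ⊆ insert 0 (W ∩ P) ∪ insert 0 (W ∩ Q) := by
      intro w hw
      rcases extremePoints_oplus_subset hw with h1 | h1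
      · exact Or.inl (Or.inr ⟨hw, h1.1⟩)
      · exact Or.inr (Or.inr ⟨hw, h1.1⟩)
    have hp' : p ∈ convexHull ℝ (insert 0 (W ∩ P) ∪ insert 0 (W ∩ Q)) := by
      refine convexHull_mono hsplit ?_
      rw [hW, (hP.oplus hQ).convexHull_extremePoints]
      exact subset_convexHull ℝ _ (Or.inl hp)
    rw [convexHull_union (Set.insert_nonempty _ _) (Set.insert_nonempty _ _),
      mem_convexJoin] at hp'
    obtain ⟨x, hx, y, hy, a, b, ha, hb, hab, hxy⟩ := hp'
    have hx' := convexHull_min hA (Submodule.span ℝ P).convex hx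
    have hy' := convexHull_min hB (Submodule.span ℝ Q).convex hy
    have h1 := (eq_of_add_eq_add h (Submodule.smul_mem _ a hx') (Submodule.subset_span hp)
      (Submodule.smul_mem _ b hy') (Submodule.zero_mem _) (by rw [hxy, add_zero])).1
    rw [← h1]
    exact (convex_convexHull ℝ _).smul_mem_of_zero_mem
      (subset_convexHull ℝ _ (Set.mem_insert _ _)) hx ⟨ha, by linarith⟩
  have heq : convexHull ℝ (insert 0 (W ∩ P)) = P :=
    (convexHull_min (Set.insert_subset hP0 fun w hw => hw.2) hP.convex).antisymm hsub
  intro v hv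
  rw [← heq] at hv
  rcases extremePoints_convexHull_subset hv with h1 | h1
  · exact Or.inl h1
  · exact Or.inr h1.1

lemma den_oplus (hP : IsRationalPolytope P) (hQ : IsRationalPolytope Q)
    (hP0 : (0 : Fin n → ℝ) ∈ P) (hQ0 : (0 : Fin n → ℝ) ∈ Q)
    (h : Disjoint (Submodule.span ℝ P) (Submodule.span ℝ Q)) :
    den (oplus P Q) = Nat.lcm (den P) (den Q) := by
  have key : ∀ k : ℕ, den (oplus P Q) ∣ k ↔ den P ∣ k ∧ den Q ∣ k := by
    intro k
    rw [(hP.oplus hQ).den_dvd_iff, hP.den_dvd_iff, hQ.den_dvd_iff]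
    have h0 : (k : ℝ) • (0 : Fin n → ℝ) ∈ integerLattice n := by
      rw [smul_zero]
      exact (latticeSubgroup n).zero_mem
    constructor
    · intro hk
      constructor
      · intro v hv
        rcases extremePoints_subset_insert hP.1 hQ.1 hP0 h hv with rfl | h1
        · exact h0
        · exact hk v h1
      · intro v hv
        rcases extremePoints_subset_insert hQ.1 hP.1 hQ0 h.symm hv with rfl | h1
        · exact h0
        · exact hk v (oplus_comm (P := P) ▸ h1)
    · rintro ⟨h1, h2⟩ v hv
      rcases extremePoints_oplus_subset hv with h3 | h3
      · exact h1 v h3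
      · exact h2 v h3
  refine Nat.dvd_antisymm ((key _).2 ⟨Nat.dvd_lcm_left _ _, Nat.dvd_lcm_right _ _⟩) ?_
  have := (key _).1 dvd_rfl
  exact Nat.lcm_dvd this.1 this.2

end FreeSum

/-! ### Vertices of polar polyhedra -/

section Polar

variable {ι E : Type*} [AddCommGroup E] [Module ℝ E]

/-- The polyhedron of all linear functionals that are at most `1` at the points `v i`. -/
def polarOf (v : ι → E) : Set (Module.Dual ℝ E) := {φ | ∀ i, φ (v i) ≤ 1}

/-- The span of the points `v i` at which the inequality `φ (v i) ≤ 1` is tight. -/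
def tightSpan (v : ι → E) (φ : Module.Dual ℝ E) : Submodule ℝ E :=
  Submodule.span ℝ (v '' {i | φ (v i) = 1})

lemma mem_tightSpan {v : ι → E} {φ : Module.Dual ℝ E} {i : ι} (h : φ (v i) = 1) :
    v i ∈ tightSpan v φ :=
  Submodule.subset_span ⟨i, h, rfl⟩

lemma exists_dual_tightSpan {v : ι → E} {φ : Module.Dual ℝ E} (h : tightSpan v φ ≠ ⊤) :
    ∃ ψ : Module.Dual ℝ E, ψ ≠ 0 ∧ ∀ i, φ (v i) = 1 → ψ (v i) = 0 := by
  obtain ⟨ψ, h0, hle⟩ := Submodule.exists_le_ker_of_lt_top _ (lt_top_iff_ne_top.2 h)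
  exact ⟨ψ, h0, fun i hi => hle (mem_tightSpan hi)⟩

lemma mem_extremePoints_polarOf {v : ι → E} {φ : Module.Dual ℝ E} (h : φ ∈ polarOf v)
    (ht : tightSpan v φ = ⊤) : φ ∈ (polarOf v).extremePoints ℝ := by
  refine ⟨h, ?_⟩
  rintro φ₁ h₁ φ₂ h₂ ⟨a, b, ha, hb, hab, heq⟩
  refine LinearMap.ext_on ht ?_
  rintro _ ⟨i, hi, rfl⟩
  have hi' : φ (v i) = 1 := hi
  have h3 : a * φ₁ (v i) + b * φ₂ (v i) = 1 := by
    rw [← hi', ← heq]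
    simp
  have h4 := mul_le_mul_of_nonneg_left (h₂ i) hb.le
  have h5 : a * 1 ≤ a * φ₁ (v i) := by linarith
  rw [hi']
  exact le_antisymm (h₁ i) (le_of_mul_le_mul_left h5 ha)

variable [Fintype ι]

lemma tightSpan_eq_top {v : ι → E} {φ : Module.Dual ℝ E} (h : φ ∈ (polarOf v).extremePoints ℝ) :
    tightSpan v φ = ⊤ := by
  by_contra hne
  obtain ⟨ψ, h0, hψ⟩ := exists_dual_tightSpan hne
  -- both `φ + ε ψ` and `φ - ε ψ` lie in the polar for small `ε`
  obtain ⟨ε, hε, hεb⟩ : ∃ ε : ℝ, 0 < ε ∧ ∀ i, φ (v i) + ε * |ψ (v i)| ≤ 1 := by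
    have hev : ∀ᶠ ε : ℝ in nhdsWithin 0 (Set.Ioi 0), ∀ i, φ (v i) + ε * |ψ (v i)| ≤ 1 := by
      rw [Filter.eventually_all]
      intro i
      rcases (h.1 i).eq_or_lt with hi | hi
      · exact Filter.Eventually.of_forall fun ε => by simp [hψ i hi, hi]
      · have hc : Filter.Tendsto (fun ε : ℝ => φ (v i) + ε * |ψ (v i)|)
            (nhdsWithin 0 (Set.Ioi 0)) (nhds (φ (v i))) := by
          have : Continuous fun ε : ℝ => φ (v i) + ε * |ψ (v i)| := by fun_prop
          simpa using (this.tendsto 0).mono_left nhdsWithin_le_nhds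
        filter_upwards [hc.eventually (gt_mem_nhds hi)] with ε h using h.le
    obtain ⟨ε, h1, h2⟩ := (hev.and self_mem_nhdsWithin).exists
    exact ⟨ε, h2, h1⟩
  have h1 : φ + ε • ψ ∈ polarOf v := fun i => by
    have := mul_le_mul_of_nonneg_left (le_abs_self (ψ (v i))) hε.le
    have := hεb i
    simp only [LinearMap.add_apply, LinearMap.smul_apply, smul_eq_mul]
    linarith
  have h2 : φ - ε • ψ ∈ polarOf v := fun i => by
    have := mul_le_mul_of_nonneg_left (neg_le_abs (ψ (v i))) hε.le
    have := hεb i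
    simp only [LinearMap.sub_apply, LinearMap.smul_apply, smul_eq_mul]
    linarith
  have h3 : φ ∈ openSegment ℝ (φ + ε • ψ) (φ - ε • ψ) :=
    ⟨1 / 2, 1 / 2, by norm_num, by norm_num, by norm_num, by module⟩
  have h4 : φ + ε • ψ = φ := h.2 h1 h2 h3
  rw [add_eq_left, smul_eq_zero] at h4
  exact h4.elim hε.ne' h0

/-- From a point of the polar that is not a vertex one can move, without decreasing the value at a
point `x` of the cone over the `v i`, until a further inequality becomes tight. -/
lemma exists_tightSpan_lt {v : ι → E} (hv : Submodule.span ℝ (Set.range v) = ⊤)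
    {φ : Module.Dual ℝ E} (h : φ ∈ polarOf v) (hne : tightSpan v φ ≠ ⊤) {c : ι → ℝ}
    (hc : ∀ i, 0 ≤ c i) {x : E} (hx : ∑ i, c i • v i = x) :
    ∃ φ' ∈ polarOf v, φ x ≤ φ' x ∧ tightSpan v φ < tightSpan v φ' := by
  obtain ⟨ψ, hψx, ⟨j, hj⟩, hψ⟩ : ∃ ψ : Module.Dual ℝ E, 0 ≤ ψ x ∧ (∃ i, 0 < ψ (v i)) ∧
      ∀ i, φ (v i) = 1 → ψ (v i) = 0 := by
    obtain ⟨ψ, h0, hψ⟩ := exists_dual_tightSpan hne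
    have hpos : ∀ ψ : Module.Dual ℝ E, 0 < ψ x → ∃ i, 0 < ψ (v i) := by
      intro ψ hψx
      by_contra! hle
      refine absurd hψx (not_lt.2 ?_)
      rw [← hx, map_sum]
      refine Finset.sum_nonpos fun i _ => ?_
      rw [map_smul, smul_eq_mul]
      exact mul_nonpos_of_nonneg_of_nonpos (hc i) (hle i)
    rcases lt_trichotomy (ψ x) 0 with hlt | heq | hgt
    · exact ⟨-ψ, by simpa using hlt.le, hpos (-ψ) (by simpa using hlt),
        fun i hi => by simp [hψ i hi]⟩
    · obtain ⟨i, hi⟩ : ∃ i, ψ (v i) ≠ 0 := by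
        by_contra! hall
        refine h0 (LinearMap.ext_on hv ?_)
        rintro _ ⟨i, rfl⟩
        simpa using hall i
      rcases lt_or_gt_of_ne hi with hlt | hgt
      · exact ⟨-ψ, by simp [heq], ⟨i, by simpa using hlt⟩, fun i hi => by simp [hψ i hi]⟩
      · exact ⟨ψ, heq.ge, ⟨i, hgt⟩, hψ⟩
    · exact ⟨ψ, hgt.le, hpos ψ hgt, hψ⟩
  obtain ⟨i₀, hi₀, hmin⟩ := Finset.exists_min_image (Finset.univ.filter fun i => 0 < ψ (v i))
    (fun i => (1 - φ (v i)) / ψ (v i)) ⟨j, by simpa using hj⟩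
  have hi₀' : 0 < ψ (v i₀) := by simpa using hi₀
  set s : ℝ := (1 - φ (v i₀)) / ψ (v i₀) with hs
  have hs0 : 0 ≤ s := div_nonneg (by linarith [h i₀]) hi₀'.le
  have hs1 : s * ψ (v i₀) = 1 - φ (v i₀) := div_mul_cancel₀ _ hi₀'.ne'
  refine ⟨φ + s • ψ, fun i => ?_, ?_, ?_⟩
  · simp only [LinearMap.add_apply, LinearMap.smul_apply, smul_eq_mul]
    rcases lt_or_ge 0 (ψ (v i)) with hi | hi
    · have h1 := hmin i (by simpa using hi)
      rw [le_div_iff₀ hi] at h1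
      linarith
    · have := mul_nonpos_of_nonneg_of_nonpos hs0 hi
      linarith [h i]
  · have := mul_nonneg hs0 hψx
    simp only [LinearMap.add_apply, LinearMap.smul_apply, smul_eq_mul]
    linarith
  · rw [SetLike.lt_iff_le_and_exists]
    refine ⟨Submodule.span_mono ?_, v i₀, mem_tightSpan ?_, fun hmem => ?_⟩
    · rintro _ ⟨i, hi, rfl⟩
      have hi' : φ (v i) = 1 := hi
      exact ⟨i, by simp [hi', hψ i hi'], rfl⟩
    · simp only [LinearMap.add_apply, LinearMap.smul_apply, smul_eq_mul]
      linarith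
    · have hker : tightSpan v φ ≤ LinearMap.ker ψ := Submodule.span_le.2 (by
        rintro _ ⟨i, hi, rfl⟩
        exact hψ i hi)
      exact hi₀'.ne' (hker hmem)

/-- If `x` lies in the cone over the `v i`, then every value of `φ ↦ φ x` on the polar is dominated
by its value at a vertex. -/
lemma exists_extremePoint_ge [FiniteDimensional ℝ E] {v : ι → E}
    (hv : Submodule.span ℝ (Set.range v) = ⊤) {φ : Module.Dual ℝ E} (h : φ ∈ polarOf v)
    {c : ι → ℝ} (hc : ∀ i, 0 ≤ c i) {x : E} (hx : ∑ i, c i • v i = x) :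
    ∃ φ' ∈ (polarOf v).extremePoints ℝ, φ x ≤ φ' x := by
  obtain ⟨_, ⟨φ', ⟨h1, h2⟩, rfl⟩, hmax⟩ := (wellFounded_gt (α := Submodule ℝ E)).has_min
    (tightSpan v '' {φ' | φ' ∈ polarOf v ∧ φ x ≤ φ' x}) ⟨_, φ, ⟨h, le_rfl⟩, rfl⟩
  refine ⟨φ', mem_extremePoints_polarOf h1 ?_, h2⟩
  by_contra hne
  obtain ⟨φ'', h3, h4, h5⟩ := exists_tightSpan_lt hv h1 hne hc hx
  exact hmax _ ⟨φ'', ⟨h3, h2.trans h4⟩, rfl⟩ h5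

end Polar

/-! ### Lattice polyhedra and integral gauges -/

section Gauge

variable {n : ℕ} {P : Set (Fin n → ℝ)}

/-- The gauge of `P` takes integer values at the lattice points at which it is finite: if a lattice
point lies in `a P`, then it lies in `⌊a⌋ P`. -/
def IsGaugeIntegral (P : Set (Fin n → ℝ)) : Prop :=
  ∀ x ∈ integerLattice n, ∀ a : ℝ, 0 ≤ a → x ∈ dilate a P → x ∈ dilate (⌊a⌋₊ : ℝ) P

/-- A point outside of `m P` is separated from it by a functional that is at most `1` on `P`. -/
lemma exists_dual_gt (hP : IsPolytope P) (h0 : (0 : Fin n → ℝ) ∈ P) {m : ℝ} (hm : 0 ≤ m)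
    {x : Fin n → ℝ} (hx : x ∉ dilate m P) :
    ∃ f : Module.Dual ℝ (Fin n → ℝ), (∀ p ∈ P, f p ≤ 1) ∧ m < f x := by
  have hconv : Convex ℝ (dilate m P) := (hP.dilate m).convex
  have hzero : (0 : Fin n → ℝ) ∈ dilate m P := ⟨0, h0, by simp⟩
  obtain ⟨f, u, hfu, hux⟩ := geometric_hahn_banach_closed_point hconv
    (isCompact_dilate hP.isCompact m).isClosed hx
  have hu : 0 < u := by simpa using hfu 0 hzero
  rcases hm.eq_or_lt with rfl | hm
  · obtain ⟨C, hC⟩ := (hP.isCompact.image f.continuous).bddAbove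
    have hC' : ∀ p ∈ P, f p ≤ max C 1 := fun p hp => (hC ⟨p, hp, rfl⟩).trans (le_max_left _ _)
    have hpos : 0 < max C 1 := lt_max_of_lt_right one_pos
    refine ⟨(max C 1)⁻¹ • f.toLinearMap, fun p hp => ?_, ?_⟩
    · simp only [LinearMap.smul_apply, ContinuousLinearMap.coe_coe, smul_eq_mul]
      rw [inv_mul_le_iff₀ hpos, mul_one]
      exact hC' p hp
    · simp only [LinearMap.smul_apply, ContinuousLinearMap.coe_coe, smul_eq_mul]
      exact mul_pos (inv_pos.2 hpos) (hu.trans hux)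
  · refine ⟨(m / u) • f.toLinearMap, fun p hp => ?_, ?_⟩
    · have h1 := hfu _ ⟨p, hp, rfl⟩
      simp only [map_smul, smul_eq_mul] at h1
      simp only [LinearMap.smul_apply, ContinuousLinearMap.coe_coe, smul_eq_mul]
      rw [div_mul_eq_mul_div, div_le_one hu]
      exact h1.le
    · simp only [LinearMap.smul_apply, ContinuousLinearMap.coe_coe, smul_eq_mul]
      rw [div_mul_eq_mul_div, lt_div_iff₀ hu]
      exact mul_lt_mul_of_pos_left hux hm

lemma le_of_mem_dilate {φ : Module.Dual ℝ (Submodule.span ℝ P)} (h : φ ∈ polarDual P) {a : ℝ}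
    (ha : 0 ≤ a) {x : Submodule.span ℝ P} (hx : (x : Fin n → ℝ) ∈ dilate a P) : φ x ≤ a := by
  obtain ⟨p, hp, hpx⟩ := hx
  have h1 : x = a • (⟨p, Submodule.subset_span hp⟩ : Submodule.span ℝ P) :=
    Subtype.ext hpx.symm
  rw [h1, map_smul, smul_eq_mul]
  exact mul_le_of_le_one_right ha (h _ hp)

/-- `P^∨` is a lattice polyhedron if and only if the gauge of `P` is integral on lattice points.
The gauge is the maximum of the vertices of `P^∨`, and each vertex agrees with the gauge on a
full-dimensional rational cone, whose lattice points generate the lattice. -/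
theorem dualIsLatticePolyhedron_iff (hP : IsRationalPolytope P) (h0 : (0 : Fin n → ℝ) ∈ P) :
    DualIsLatticePolyhedron P ↔ IsGaugeIntegral P := by
  obtain ⟨m, v, hv⟩ := hP.1.exists_range_eq
  have hPv : P = convexHull ℝ (Set.range v) := by rw [hv, hP.1.convexHull_extremePoints]
  have hvP : ∀ i, v i ∈ P := fun i => hPv ▸ subset_convexHull ℝ _ ⟨i, rfl⟩
  have hne : Nonempty (Fin m) := by
    by_contra hm
    rw [not_nonempty_iff] at hm
    rw [hPv, Set.range_eq_empty, convexHull_empty] at h0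
    exact h0
  let w : Fin m → Submodule.span ℝ P := fun i => ⟨v i, Submodule.subset_span (hvP i)⟩
  have hw : Submodule.span ℝ (Set.range w) = ⊤ := by
    refine Submodule.map_injective_of_injective (Submodule.span ℝ P).injective_subtype ?_
    rw [Submodule.map_span, Submodule.map_top, Submodule.range_subtype, ← Set.range_comp]
    conv_rhs => rw [hPv, span_convexHull_eq]
    rfl
  have hdil : ∀ (a : ℝ), 0 ≤ a → ∀ x : Fin n → ℝ, x ∈ dilate a P ↔
      ∃ l : Fin m → ℝ, (∀ i, 0 ≤ l i) ∧ ∑ i, l i = a ∧ ∑ i, l i • v i = x := by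
    intro a ha x
    rw [← mem_dilate_convexHull_range v ha, ← hPv]
  have hpolar : polarDual P = polarOf w := by
    ext φ
    constructor
    · exact fun h i => h (w i) (hvP i)
    · intro h x hx
      obtain ⟨l, h1, h2, h3⟩ := (mem_convexHull_range_iff v _).1 (hPv.subset hx)
      have h4 : x = ∑ i, l i • w i := Subtype.ext (by simp [← h3, w])
      rw [h4, map_sum, ← h2]
      refine Finset.sum_le_sum fun i _ => ?_
      rw [map_smul, smul_eq_mul]
      exact mul_le_of_le_one_right (h1 i) (h i)
  constructor
  · intro hdual x hx a ha hxa
    by_contra hnot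
    obtain ⟨f, hf, hfx⟩ := exists_dual_gt hP.1 h0 (Nat.cast_nonneg ⌊a⌋₊) hnot
    obtain ⟨l, h1, -, h3⟩ := (hdil a ha x).1 hxa
    let y : Submodule.span ℝ P := ⟨x, dilate_subset_span a hxa⟩
    obtain ⟨φ, hφ, hle⟩ := exists_extremePoint_ge hw
      (φ := f.comp (Submodule.span ℝ P).subtype) (fun i => hf _ (hvP i)) h1 (x := y)
      (Subtype.ext (by simp [← h3, w, y]))
    rw [← hpolar] at hφ
    obtain ⟨k, hk⟩ := hdual φ hφ y hx
    have h5 : φ y ≤ a := le_of_mem_dilate hφ.1 ha hxa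
    have h6 : (⌊a⌋₊ : ℝ) < φ y := hfx.trans_le hle
    rw [hk] at h5 h6
    -- there is no integer `k` with `⌊a⌋ < k ≤ a`
    have h7 : k ≤ ⌊a⌋ := Int.le_floor.2 h5
    have h8 : ((⌊a⌋₊ : ℤ) : ℝ) < (k : ℝ) := by exact_mod_cast h6
    rw [Int.natCast_floor_eq_floor ha] at h8
    exact absurd (Int.cast_lt.1 h8) (not_lt.2 h7)
  · intro hgauge φ hφ e he
    have ht : tightSpan w φ = ⊤ := tightSpan_eq_top (hpolar ▸ hφ)
    have hD : ∀ i, (den P : ℝ) • v i ∈ integerLattice n :=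
      fun i => hP.den_smul_mem (hv ▸ ⟨i, rfl⟩)
    -- write `e` as a linear combination of the tight generators
    obtain ⟨c, hc, hce⟩ : ∃ c : Fin m → ℝ, (∀ i, φ (w i) ≠ 1 → c i = 0) ∧
        ∑ i, c i • w i = e := by
      have hmem : e ∈ tightSpan w φ := ht ▸ Submodule.mem_top
      obtain ⟨c, hc, hce⟩ := (Finsupp.mem_span_image_iff_linearCombination ℝ).1 hmem
      refine ⟨c, fun i hi => (Finsupp.mem_supported' ℝ c).1 hc i hi, ?_⟩
      rw [← hce, Finsupp.linearCombination_apply,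
        Finsupp.sum_fintype c (fun i a => a • w i) fun i => zero_smul ℝ (w i)]
    -- translating `e` by a lattice point far inside the cone over the tight generators moves it
    -- into this cone
    obtain ⟨N, hN⟩ : ∃ N : ℕ, ∀ i, 0 ≤ c i + N := by
      obtain ⟨N, hN⟩ := exists_nat_ge (∑ i, |c i|)
      refine ⟨N, fun i => ?_⟩
      have h1 := Finset.single_le_sum (f := fun i => |c i|) (fun i _ => abs_nonneg _)
        (Finset.mem_univ i)
      have h2 := neg_abs_le (c i)
      linarith
    have hDpos : (1 : ℝ) ≤ den P := by exact_mod_cast hP.den_pos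
    classical
    let δ : Fin m → ℝ := fun i => if φ (w i) = 1 then (N * den P : ℝ) else 0
    have hδ : ∀ i, φ (w i) ≠ 1 → δ i = 0 := fun i hi => by simp [δ, hi]
    have hδL : ∑ i, δ i • v i ∈ integerLattice n := by
      refine (latticeSubgroup n).sum_mem fun i _ => ?_
      by_cases hi : φ (w i) = 1
      · simp only [δ, if_pos hi, mul_smul]
        exact natCast_smul_mem_integerLattice (hD i) N
      · simp only [δ, if_neg hi, zero_smul]
        exact (latticeSubgroup n).zero_mem
    have hval : ∀ d : Fin m → ℝ, (∀ i, φ (w i) ≠ 1 → d i = 0) →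
        φ (∑ i, d i • w i) = ∑ i, d i := by
      intro d hd
      rw [map_sum]
      refine Finset.sum_congr rfl fun i _ => ?_
      rw [map_smul, smul_eq_mul]
      by_cases hi : φ (w i) = 1
      · rw [hi, mul_one]
      · rw [hd i hi, zero_mul]
    set l : Fin m → ℝ := fun i => c i + δ i with hl
    have hl0 : ∀ i, 0 ≤ l i := by
      intro i
      by_cases hi : φ (w i) = 1
      · simp only [hl, δ, if_pos hi]
        have h1 : (N : ℝ) * 1 ≤ N * den P := mul_le_mul_of_nonneg_left hDpos N.cast_nonneg
        linarith [hN i]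
      · simp [hl, δ, hi, hc i hi]
    have hsum : ∑ i, l i • w i = e + ∑ i, δ i • w i := by
      simp [hl, add_smul, Finset.sum_add_distrib, hce]
    have hsum0 : 0 ≤ ∑ i, l i := Finset.sum_nonneg fun i _ => hl0 i
    have hz : ((∑ i, l i • w i : Submodule.span ℝ P) : Fin n → ℝ) = ∑ i, l i • v i := by
      simp [w]
    have hzL : ((∑ i, l i • w i : Submodule.span ℝ P) : Fin n → ℝ) ∈ integerLattice n := by
      rw [hsum, Submodule.coe_add]
      refine (latticeSubgroup n).add_mem he ?_
      have : ((∑ i, δ i • w i : Submodule.span ℝ P) : Fin n → ℝ) = ∑ i, δ i • v i := by simp [w]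
      rw [this]
      exact hδL
    have hz1 := hgauge _ hzL _ hsum0 ((hdil _ hsum0 _).2 ⟨l, hl0, rfl, hz.symm⟩)
    have hz2 := le_of_mem_dilate hφ.1 (Nat.cast_nonneg _) hz1
    rw [hval l fun i hi => by simp [hl, hc i hi, hδ i hi]] at hz2
    have hz3 : ∑ i, l i = (⌊∑ i, l i⌋₊ : ℝ) := le_antisymm hz2 (Nat.floor_le hsum0)
    have hδsum : ∃ k : ℕ, ∑ i, δ i = k := by
      refine ⟨∑ i, if φ (w i) = 1 then N * den P else 0, ?_⟩
      push_cast
      rfl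
    obtain ⟨k, hk⟩ := hδsum
    refine ⟨(⌊∑ i, l i⌋₊ : ℤ) - k, ?_⟩
    have h9 : φ e = ∑ i, l i - ∑ i, δ i := by
      rw [← hce, hval c hc]
      simp [hl, Finset.sum_add_distrib]
    rw [h9, hk]
    push_cast
    rw [← hz3]

end Gauge

/-! ### Splitting of lattice points in a free sum -/

section Splitting

variable {n : ℕ} {P Q : Set (Fin n → ℝ)}

lemma mem_coordSubspace {I : Finset (Fin n)} {x : Fin n → ℝ} :
    x ∈ coordSubspace I ↔ ∀ i ∉ I, x i = 0 := by
  constructor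
  · intro hx i hi
    have hle : coordSubspace I ≤ LinearMap.ker (LinearMap.proj (R := ℝ) (φ := fun _ => ℝ) i) := by
      refine Submodule.span_le.2 ?_
      rintro _ ⟨j, hj, rfl⟩
      have hij : i ≠ j := fun h => hi (h ▸ hj)
      simp [hij]
    exact hle hx
  · intro h
    rw [← Finset.univ_sum_single x]
    refine Submodule.sum_mem _ fun i _ => ?_
    by_cases hi : i ∈ I
    · have h1 : (Pi.single i (x i) : Fin n → ℝ) = x i • Pi.single i (1 : ℝ) := by
        rw [← Pi.single_smul, smul_eq_mul, mul_one]
      rw [h1]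
      exact Submodule.smul_mem _ _ (Submodule.subset_span ⟨i, hi, rfl⟩)
    · simp [h i hi]

lemma mulVec_mem_integerLattice (M : Matrix (Fin n) (Fin n) ℤ) {x : Fin n → ℝ}
    (hx : x ∈ integerLattice n) :
    (M.map fun m : ℤ => (m : ℝ)).mulVec x ∈ integerLattice n := by
  choose m hm using hx
  intro i
  refine ⟨∑ j, M i j * m j, ?_⟩
  simp [Matrix.mulVec, dotProduct, hm]

/-- The properties of a free sum that the argument uses. They are invariant under `SL_n(ℤ)`: the
linear spans are complementary, and so are the lattices in them. -/
lemma IsFreeSum.properties (h : IsFreeSum P Q) :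
    (0 : Fin n → ℝ) ∈ P ∧ (0 : Fin n → ℝ) ∈ Q ∧
      Disjoint (Submodule.span ℝ P) (Submodule.span ℝ Q) ∧
      ∀ z ∈ integerLattice n, z ∈ Submodule.span ℝ P ⊔ Submodule.span ℝ Q →
        ∃ x ∈ integerLattice n, ∃ y ∈ integerLattice n,
          x ∈ Submodule.span ℝ P ∧ y ∈ Submodule.span ℝ Q ∧ x + y = z := by
  obtain ⟨A, hP0, hQ0, I, J, hIJ, hI, hJ⟩ := h
  set M : Matrix (Fin n) (Fin n) ℝ :=
    (A : Matrix (Fin n) (Fin n) ℤ).map (fun m : ℤ => (m : ℝ)) with hM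
  set M' : Matrix (Fin n) (Fin n) ℝ :=
    ((A⁻¹ : Matrix.SpecialLinearGroup (Fin n) ℤ) : Matrix (Fin n) (Fin n) ℤ).map
      (fun m : ℤ => (m : ℝ)) with hM'
  have hmul : ∀ B C : Matrix.SpecialLinearGroup (Fin n) ℤ, B * C = 1 →
      (B : Matrix (Fin n) (Fin n) ℤ).map (fun m : ℤ => (m : ℝ)) *
        (C : Matrix (Fin n) (Fin n) ℤ).map (fun m : ℤ => (m : ℝ)) = 1 := by
    intro B C hBC
    have h1 := Matrix.map_mul (L := (B : Matrix (Fin n) (Fin n) ℤ))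
      (M := (C : Matrix (Fin n) (Fin n) ℤ)) (f := Int.castRingHom ℝ)
    rw [← Matrix.SpecialLinearGroup.coe_mul, hBC, Matrix.SpecialLinearGroup.coe_one,
      Matrix.map_one _ (map_zero _) (map_one _)] at h1
    exact h1.symm
  have h12 : ∀ x, M.mulVec (M'.mulVec x) = x := fun x => by
    rw [Matrix.mulVec_mulVec, hmul A A⁻¹ (mul_inv_cancel A), Matrix.one_mulVec]
  have h21 : ∀ x, M'.mulVec (M.mulVec x) = x := fun x => by
    rw [Matrix.mulVec_mulVec, hmul A⁻¹ A (inv_mul_cancel A), Matrix.one_mulVec]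
  have hinj : Function.Injective M.mulVec := Function.LeftInverse.injective h21
  have hspan : ∀ (R : Set (Fin n → ℝ)) (K : Finset (Fin n)),
      Submodule.span ℝ (slImage A R) = coordSubspace K → ∀ x,
        x ∈ Submodule.span ℝ R ↔ ∀ i ∉ K, M.mulVec x i = 0 := by
    intro R K hRK x
    rw [← mem_coordSubspace, ← hRK]
    have h1 : slImage A R = M.mulVecLin '' R := rfl
    have h2 : Function.Injective M.mulVecLin := hinj
    rw [h1, ← Submodule.map_span]
    exact ⟨fun h => ⟨x, h, rfl⟩, fun ⟨y, hy, hyx⟩ => h2 hyx ▸ hy⟩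
  have hzero : ∀ R : Set (Fin n → ℝ), (0 : Fin n → ℝ) ∈ slImage A R → (0 : Fin n → ℝ) ∈ R := by
    rintro R ⟨x, hx, hx0⟩
    have : x = 0 := hinj (hx0.trans (Matrix.mulVec_zero M).symm)
    exact this ▸ hx
  have hspanP := hspan P I hI
  have hspanQ := hspan Q J hJ
  have hdisj := Finset.disjoint_left.1 hIJ
  refine ⟨hzero P hP0, hzero Q hQ0, ?_, ?_⟩
  · rw [Submodule.disjoint_def]
    intro x hxP hxQ
    refine hinj ?_
    rw [Matrix.mulVec_zero]
    ext i
    by_cases hi : i ∈ I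
    · exact (hspanQ x).1 hxQ i (hdisj hi)
    · exact (hspanP x).1 hxP i hi
  · intro z hz hzPQ
    obtain ⟨p, hp, q, hq, rfl⟩ := Submodule.mem_sup.1 hzPQ
    -- in the coordinates given by `A`, the summands `p` and `q` are coordinate projections of `z`
    have hAz : M.mulVec (p + q) ∈ integerLattice n := mulVec_mem_integerLattice _ hz
    have hAp : M.mulVec p ∈ integerLattice n := by
      intro i
      by_cases hi : i ∈ I
      · have h1 := hAz i
        rw [Matrix.mulVec_add, Pi.add_apply, (hspanQ q).1 hq i (hdisj hi), add_zero] at h1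
        exact h1
      · exact ⟨0, by simpa using (hspanP p).1 hp i hi⟩
    have hpL : p ∈ integerLattice n := by
      rw [← h21 p]
      exact mulVec_mem_integerLattice _ hAp
    have hqL : q ∈ integerLattice n := by
      have := (latticeSubgroup n).sub_mem hz hpL
      rwa [add_sub_cancel_left] at this
    exact ⟨p, hpL, q, hqL, hp, hq, rfl⟩

/-- The lattice points of every dilate `k (P ⊕ Q)` are sums of lattice points of `i P` and `j Q`
with integers `i + j = k`. -/
def LatticePointsSplit (P Q : Set (Fin n → ℝ)) : Prop :=
  ∀ k : ℕ, ∀ x ∈ integerLattice n, ∀ y ∈ integerLattice n,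
    x ∈ Submodule.span ℝ P → y ∈ Submodule.span ℝ Q → x + y ∈ dilate (k : ℝ) (oplus P Q) →
      ∃ i j : ℕ, i + j = k ∧ x ∈ dilate (i : ℝ) P ∧ y ∈ dilate (j : ℝ) Q

lemma LatticePointsSplit.symm (h : LatticePointsSplit P Q) : LatticePointsSplit Q P := by
  intro k x hx y hy hxQ hyP hxy
  rw [add_comm, oplus_comm] at hxy
  obtain ⟨i, j, hij, h1, h2⟩ := h k y hy x hx hyP hxQ hxy
  exact ⟨j, i, by rw [add_comm, hij], h2, h1⟩

lemma IsGaugeIntegral.latticePointsSplit (h : IsGaugeIntegral P) (hP : Convex ℝ P)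
    (hQ : Convex ℝ Q) (hP0 : (0 : Fin n → ℝ) ∈ P) (hQ0 : (0 : Fin n → ℝ) ∈ Q)
    (hd : Disjoint (Submodule.span ℝ P) (Submodule.span ℝ Q)) : LatticePointsSplit P Q := by
  intro k x hx y _ hxP hyQ hxy
  obtain ⟨a, b, ha, hb, hab, x', hx', y', hy', heq⟩ :=
    (mem_dilate_oplus hP hQ ⟨0, hP0⟩ ⟨0, hQ0⟩ (Nat.cast_nonneg k)).1 hxy
  obtain ⟨rfl, rfl⟩ := eq_of_add_eq_add hd hxP (dilate_subset_span _ hx') hyQ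
    (dilate_subset_span _ hy') heq.symm
  have h1 : ⌊a⌋₊ ≤ k := by
    have : (⌊a⌋₊ : ℝ) ≤ k := (Nat.floor_le ha).trans (by linarith)
    exact_mod_cast this
  refine ⟨⌊a⌋₊, k - ⌊a⌋₊, Nat.add_sub_cancel' h1, h x hx a ha hx', dilate_mono hQ hQ0 hb ?_ hy'⟩
  rw [Nat.cast_sub h1]
  linarith [Nat.floor_le ha]

/-- The gauge of a compact convex set is attained. -/
lemma exists_isLeast_dilate (hP : Convex ℝ P) (hc : IsCompact P) (h0 : (0 : Fin n → ℝ) ∈ P)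
    {x : Fin n → ℝ} {a : ℝ} (ha : 0 ≤ a) (hx : x ∈ dilate a P) :
    ∃ g : ℝ, 0 ≤ g ∧ ∀ b : ℝ, 0 ≤ b → (x ∈ dilate b P ↔ g ≤ b) := by
  have hcl : IsClosed {t : ℝ × (Fin n → ℝ) | t.1 • t.2 = x} :=
    isClosed_eq (continuous_fst.smul continuous_snd) continuous_const
  have hcomp : IsCompact (Prod.fst '' ((Set.Icc 0 a ×ˢ P) ∩
      {t : ℝ × (Fin n → ℝ) | t.1 • t.2 = x})) :=
    ((isCompact_Icc.prod hc).inter_right hcl).image continuous_fst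
  obtain ⟨p, hp, hpx⟩ := hx
  obtain ⟨g, ⟨⟨g', q⟩, ⟨⟨⟨hg0, hga⟩, hq⟩, hgq⟩, rfl⟩, hmin⟩ :=
    hcomp.exists_isLeast ⟨a, (a, p), ⟨⟨⟨ha, le_rfl⟩, hp⟩, hpx⟩, rfl⟩
  refine ⟨g', hg0, fun b hb => ⟨?_, fun hgb => dilate_mono hP h0 hg0 hgb ⟨q, hq, hgq⟩⟩⟩
  rintro ⟨r, hr, hrx⟩
  rcases le_total b a with hba | hab
  · exact hmin ⟨(b, r), ⟨⟨⟨hb, hba⟩, hr⟩, hrx⟩, rfl⟩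
  · exact hga.trans hab

/-- A non-integral real number has a multiple with fractional part in `(0, 1/2]`. -/
lemma exists_mul_sub_le_half {g : ℝ} {N : ℕ} (h1 : (N : ℝ) < g) (h2 : g < N + 1) :
    ∃ m K : ℕ, 0 < m ∧ (K : ℝ) < m * g ∧ m * g ≤ K + 1 / 2 := by
  by_cases hle : g ≤ N + 1 / 2
  · exact ⟨1, N, one_pos, by simpa using h1, by simpa using hle⟩
  · push Not at hle
    -- with `d = ⌈g⌉ - g < 1/2`, take the first `m` with `m d ≥ 1/2`
    have hd : 0 < N + 1 - g := by linarith
    obtain ⟨m, hm1, hm2⟩ : ∃ m : ℕ, 1 / 2 ≤ m * (N + 1 - g) ∧ m * (N + 1 - g) < 1 := by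
      refine ⟨⌈1 / 2 / (N + 1 - g)⌉₊, ?_, ?_⟩
      · rw [← div_le_iff₀ hd]
        exact Nat.le_ceil _
      · have := Nat.ceil_lt_add_one (a := 1 / 2 / (N + 1 - g)) (by positivity)
        rw [← lt_div_iff₀ hd]
        refine this.trans ?_
        rw [lt_div_iff₀ hd, add_mul, div_mul_cancel₀ _ hd.ne']
        linarith
    have hmpos : 0 < m := by
      rcases Nat.eq_zero_or_pos m with rfl | h
      · norm_num at hm1
      · exact h
    have hK : 1 ≤ m * (N + 1) := Nat.one_le_iff_ne_zero.2 (by positivity)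
    refine ⟨m, m * (N + 1) - 1, hmpos, ?_, ?_⟩
    · rw [Nat.cast_sub hK]
      push_cast
      linarith
    · rw [Nat.cast_sub hK]
      push_cast
      linarith

/-- If the gauge of `P` is not integral on lattice points, then it takes a value with fractional
part in `(0, 1/2]` at some lattice point. -/
lemma exists_gauge_sub_le_half (hP : Convex ℝ P) (hc : IsCompact P) (h0 : (0 : Fin n → ℝ) ∈ P)
    (h : ¬ IsGaugeIntegral P) :
    ∃ x ∈ integerLattice n, ∃ (g : ℝ) (K : ℕ), x ∈ dilate g P ∧ (K : ℝ) < g ∧ g ≤ K + 1 / 2 ∧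
      ∀ b : ℝ, 0 ≤ b → x ∈ dilate b P → g ≤ b := by
  simp only [IsGaugeIntegral] at h
  push Not at h
  obtain ⟨x, hx, a, ha, hxa, hnot⟩ := h
  obtain ⟨g, hg0, hg⟩ := exists_isLeast_dilate hP hc h0 ha hxa
  have h1 : (⌊a⌋₊ : ℝ) < g := by
    rw [hg _ (Nat.cast_nonneg _)] at hnot
    exact not_le.1 hnot
  have h2 : g < ⌊a⌋₊ + 1 := ((hg a ha).1 hxa).trans_lt (Nat.lt_floor_add_one a)
  obtain ⟨m, K, hm, hK1, hK2⟩ := exists_mul_sub_le_half h1 h2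
  have hm0 : (0 : ℝ) < m := by exact_mod_cast hm
  refine ⟨(m : ℝ) • x, natCast_smul_mem_integerLattice hx m, m * g, K,
    smul_mem_dilate ((hg g hg0).2 le_rfl) _, hK1, hK2, fun b hb hxb => ?_⟩
  have h3 := smul_mem_dilate hxb (m : ℝ)⁻¹
  rw [inv_smul_smul₀ hm0.ne', hg _ (by positivity), inv_mul_eq_div, le_div_iff₀ hm0] at h3
  linarith

/-- If neither gauge is integral, then there are lattice points at which the gauges have fractional
parts in `(0, 1/2]`; their sum is a lattice point which does not split. -/
lemma LatticePointsSplit.isGaugeIntegral_or (h : LatticePointsSplit P Q) (hP : IsPolytope P)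
    (hQ : IsPolytope Q) (hP0 : (0 : Fin n → ℝ) ∈ P) (hQ0 : (0 : Fin n → ℝ) ∈ Q) :
    IsGaugeIntegral P ∨ IsGaugeIntegral Q := by
  by_contra! hnot
  obtain ⟨x, hx, g, K, hxg, hK1, hK2, hg⟩ :=
    exists_gauge_sub_le_half hP.convex hP.isCompact hP0 hnot.1
  obtain ⟨y, hy, g', K', hyg, hK1', hK2', hg'⟩ :=
    exists_gauge_sub_le_half hQ.convex hQ.isCompact hQ0 hnot.2
  have hgpos : 0 ≤ g := K.cast_nonneg.trans hK1.le
  have hgpos' : 0 ≤ g' := K'.cast_nonneg.trans hK1'.le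
  have hmem : x + y ∈ dilate ((K + K' + 1 : ℕ) : ℝ) (oplus P Q) := by
    refine dilate_mono (hP.oplus hQ).convex (zero_mem_oplus hP0) (add_nonneg hgpos hgpos') ?_
      ((mem_dilate_oplus hP.convex hQ.convex ⟨0, hP0⟩ ⟨0, hQ0⟩ (add_nonneg hgpos hgpos')).2
        ⟨g, g', hgpos, hgpos', rfl, x, hxg, y, hyg, rfl⟩)
    push_cast
    linarith
  obtain ⟨i, j, hij, hi, hj⟩ := h _ x hx y hy (dilate_subset_span _ hxg)
    (dilate_subset_span _ hyg) hmem
  have h1 : (K : ℝ) < i := hK1.trans_le (hg i i.cast_nonneg hi)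
  have h2 : (K' : ℝ) < j := hK1'.trans_le (hg' j j.cast_nonneg hj)
  have h3 : K < i := by exact_mod_cast h1
  have h4 : K' < j := by exact_mod_cast h2
  omega

end Splitting

/-! ### The Ehrhart series of a free sum -/

section Series

variable {n : ℕ} {P Q : Set (Fin n → ℝ)}

/-- The lattice points of `k P` that do not lie in a smaller integral dilate of `P`. -/
def shell (P : Set (Fin n → ℝ)) (k : ℕ) : Set (Fin n → ℝ) :=
  {x | x ∈ dilate (k : ℝ) P ∧ x ∈ integerLattice n ∧ ∀ j < k, x ∉ dilate (j : ℝ) P}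

lemma coeff_one_sub_X_mul_ehr (hP : Convex ℝ P) (hc : IsCompact P) (h0 : (0 : Fin n → ℝ) ∈ P)
    (k : ℕ) : PowerSeries.coeff k ((1 - PowerSeries.X) * ehr P) = ((shell P k).ncard : ℚ) := by
  rw [sub_mul, one_mul, map_sub, coeff_ehr ⟨0, h0⟩]
  cases k with
  | zero =>
    rw [PowerSeries.coeff_zero_X_mul, sub_zero]
    congr 2
    ext x
    simp [shell]
  | succ k =>
    rw [PowerSeries.coeff_succ_X_mul, coeff_ehr ⟨0, h0⟩]
    have hmono : ∀ {i j : ℕ}, i ≤ j → dilate (i : ℝ) P ⊆ dilate (j : ℝ) P := fun hij =>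
      dilate_mono hP h0 (Nat.cast_nonneg _) (by exact_mod_cast hij)
    have hshell : shell P (k + 1) = (dilate ((k + 1 : ℕ) : ℝ) P ∩ integerLattice n) \
        (dilate (k : ℝ) P ∩ integerLattice n) := by
      ext x
      constructor
      · rintro ⟨h1, h2, h3⟩
        exact ⟨⟨h1, h2⟩, fun h => h3 k k.lt_succ_self h.1⟩
      · rintro ⟨⟨h1, h2⟩, h3⟩
        exact ⟨h1, h2, fun j hj hx => h3 ⟨hmono (Nat.lt_succ_iff.1 hj) hx, h2⟩⟩
    have hcard := Set.ncard_sdiff_add_ncard_of_subset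
      (Set.inter_subset_inter_left (integerLattice n) (hmono k.le_succ))
      (finite_dilate_inter hc ((k + 1 : ℕ) : ℝ))
    rw [← Nat.succ_eq_add_one] at hshell
    rw [hshell, ← hcard]
    push_cast
    ring

/-- The pairs of lattice points of `i P` and `j Q` with `i + j = k`. -/
def splitPairs (P Q : Set (Fin n → ℝ)) (k : ℕ) : Set ((Fin n → ℝ) × (Fin n → ℝ)) :=
  {z | ∃ i j : ℕ, i + j = k ∧ z.1 ∈ dilate (i : ℝ) P ∩ integerLattice n ∧
    z.2 ∈ dilate (j : ℝ) Q ∩ integerLattice n}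

/-- The product `(1 - t) Ehr_P(t) Ehr_Q(t)` counts pairs, sorted by the least integral dilate of `P`
containing the first component. -/
lemma coeff_one_sub_X_mul_ehr_mul_ehr (hP : IsPolytope P) (hQ : IsPolytope Q)
    (hP0 : (0 : Fin n → ℝ) ∈ P) (hQ0 : (0 : Fin n → ℝ) ∈ Q) (k : ℕ) :
    (splitPairs P Q k).Finite ∧
    PowerSeries.coeff k ((1 - PowerSeries.X) * ehr P * ehr Q) = ((splitPairs P Q k).ncard : ℚ) := by
  have hunion : splitPairs P Q k = ⋃ t ∈ (Finset.HasAntidiagonal.antidiagonal k : Set (ℕ × ℕ)),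
      shell P t.1 ×ˢ (dilate (t.2 : ℝ) Q ∩ integerLattice n) := by
    ext ⟨x, y⟩
    simp only [Set.mem_iUnion, Finset.mem_coe, Finset.HasAntidiagonal.mem_antidiagonal, Set.mem_prod]
    constructor
    · classical
      rintro ⟨i, j, hij, hx, hy⟩
      have hex : ∃ i : ℕ, x ∈ dilate (i : ℝ) P := ⟨i, hx.1⟩
      have hle : Nat.find hex ≤ i := Nat.find_le hx.1
      refine ⟨(Nat.find hex, k - Nat.find hex), by omega,
        ⟨Nat.find_spec hex, hx.2, fun j hj => Nat.find_min hex hj⟩, ?_, hy.2⟩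
      refine dilate_mono hQ.convex hQ0 (Nat.cast_nonneg j) ?_ hy.1
      have : j ≤ k - Nat.find hex := by omega
      exact_mod_cast this
    · rintro ⟨⟨i, j⟩, hij, hx, hy⟩
      exact ⟨i, j, hij, ⟨hx.1, hx.2.1⟩, hy⟩
  have hfin : ∀ t ∈ (Finset.HasAntidiagonal.antidiagonal k : Set (ℕ × ℕ)),
      (shell P t.1 ×ˢ (dilate (t.2 : ℝ) Q ∩ integerLattice n)).Finite := fun t _ =>
    ((finite_dilate_inter hP.isCompact t.1).subset fun x hx => ⟨hx.1, hx.2.1⟩).prod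
      (finite_dilate_inter hQ.isCompact t.2)
  have hdisj : (Finset.HasAntidiagonal.antidiagonal k : Set (ℕ × ℕ)).PairwiseDisjoint
      fun t => shell P t.1 ×ˢ (dilate (t.2 : ℝ) Q ∩ integerLattice n) := by
    rintro ⟨i, j⟩ hij ⟨i', j'⟩ hij' hne
    rw [Finset.mem_coe, Finset.HasAntidiagonal.mem_antidiagonal] at hij hij'
    refine Set.disjoint_left.2 ?_
    rintro ⟨x, y⟩ ⟨hx, -⟩ ⟨hx', -⟩
    rcases lt_trichotomy i i' with hlt | rfl | hgt
    · exact hx'.2.2 i hlt hx.1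
    · exact hne (by simp only [Prod.mk.injEq, true_and]; simp only at hij hij'; omega)
    · exact hx.2.2 i' hgt hx'.1
  refine ⟨hunion ▸ (Finset.finite_toSet _).biUnion hfin, ?_⟩
  rw [PowerSeries.coeff_mul, hunion,
    Set.Finite.ncard_biUnion (Finset.finite_toSet _) hfin hdisj, finsum_mem_coe_finset]
  push_cast
  refine Finset.sum_congr rfl fun t _ => ?_
  rw [coeff_one_sub_X_mul_ehr hP.convex hP.isCompact hP0, coeff_ehr ⟨0, hQ0⟩, Set.ncard_prod,
    Nat.cast_mul]

/-- The lattice points of `k (P ⊕ Q)`, decomposed into their components in the spans of `P` and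
`Q`. -/
def sumPairs (P Q : Set (Fin n → ℝ)) (k : ℕ) : Set ((Fin n → ℝ) × (Fin n → ℝ)) :=
  {z | (z.1 ∈ integerLattice n ∧ z.1 ∈ Submodule.span ℝ P) ∧
    (z.2 ∈ integerLattice n ∧ z.2 ∈ Submodule.span ℝ Q) ∧
      z.1 + z.2 ∈ dilate (k : ℝ) (oplus P Q)}

lemma splitPairs_subset_sumPairs (hP : Convex ℝ P) (hQ : Convex ℝ Q) (hP0 : P.Nonempty)
    (hQ0 : Q.Nonempty) (k : ℕ) : splitPairs P Q k ⊆ sumPairs P Q k := by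
  rintro ⟨x, y⟩ ⟨i, j, hij, hx, hy⟩
  refine ⟨⟨hx.2, dilate_subset_span _ hx.1⟩, ⟨hy.2, dilate_subset_span _ hy.1⟩, ?_⟩
  exact (mem_dilate_oplus hP hQ hP0 hQ0 (Nat.cast_nonneg k)).2
    ⟨i, j, Nat.cast_nonneg i, Nat.cast_nonneg j, by exact_mod_cast hij, x, hx.1, y, hy.1, rfl⟩

lemma coeff_ehr_oplus (hP : IsPolytope P) (hQ : IsPolytope Q) (h : IsFreeSum P Q) (k : ℕ) :
    (sumPairs P Q k).Finite ∧
    PowerSeries.coeff k (ehr (oplus P Q)) = ((sumPairs P Q k).ncard : ℚ) := by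
  obtain ⟨hP0, hQ0, hd, hsplit⟩ := h.properties
  have hinj : Set.InjOn (fun z : (Fin n → ℝ) × (Fin n → ℝ) => z.1 + z.2) (sumPairs P Q k) := by
    rintro ⟨x, y⟩ ⟨⟨-, h1⟩, ⟨-, h2⟩, -⟩ ⟨x', y'⟩ ⟨⟨-, h1'⟩, ⟨-, h2'⟩, -⟩ heq
    obtain ⟨rfl, rfl⟩ := eq_of_add_eq_add hd h1 h1' h2 h2' heq
    rfl
  have himage : (fun z : (Fin n → ℝ) × (Fin n → ℝ) => z.1 + z.2) '' sumPairs P Q k =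
      dilate (k : ℝ) (oplus P Q) ∩ integerLattice n := by
    ext z
    constructor
    · rintro ⟨⟨x, y⟩, ⟨⟨h1, -⟩, ⟨h2, -⟩, h3⟩, rfl⟩
      exact ⟨h3, (latticeSubgroup n).add_mem h1 h2⟩
    · rintro ⟨h1, h2⟩
      have h3 : z ∈ Submodule.span ℝ P ⊔ Submodule.span ℝ Q := by
        rw [← Submodule.span_union, ← span_convexHull_eq]
        exact dilate_subset_span _ h1
      obtain ⟨x, hx, y, hy, hxP, hyQ, rfl⟩ := hsplit z h2 h3
      exact ⟨(x, y), ⟨⟨hx, hxP⟩, ⟨hy, hyQ⟩, h1⟩, rfl⟩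
  have hfin := finite_dilate_inter (hP.oplus hQ).isCompact (k : ℝ)
  rw [← himage] at hfin
  refine ⟨hfin.of_finite_image hinj, ?_⟩
  rw [coeff_ehr ⟨0, zero_mem_oplus hP0⟩, ← himage, hinj.ncard_image]

/-- Both sides of the equation of Ehrhart series count pairs of lattice points, and the pairs
counted on the right hand side are among those counted on the left hand side. -/
lemma ehrhartEquation_iff_latticePointsSplit (hP : IsPolytope P) (hQ : IsPolytope Q)
    (h : IsFreeSum P Q) : EhrhartEquation P Q ↔ LatticePointsSplit P Q := by
  obtain ⟨hP0, hQ0, -, -⟩ := h.properties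
  have hsub := splitPairs_subset_sumPairs hP.convex hQ.convex ⟨0, hP0⟩ ⟨0, hQ0⟩
  have h1 := coeff_ehr_oplus hP hQ h
  have h2 := coeff_one_sub_X_mul_ehr_mul_ehr hP hQ hP0 hQ0
  constructor
  · intro heq k x hx y hy hxP hyQ hxy
    have hcard : ((sumPairs P Q k).ncard : ℚ) = (splitPairs P Q k).ncard := by
      rw [← (h1 k).2, ← (h2 k).2, show ehr (oplus P Q) = _ from heq]
    have hset := Set.eq_of_subset_of_ncard_le (hsub k) (by exact_mod_cast hcard.le) (h1 k).1
    have hmem : (x, y) ∈ splitPairs P Q k := hset ▸ ⟨⟨hx, hxP⟩, ⟨hy, hyQ⟩, hxy⟩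
    obtain ⟨i, j, hij, hi, hj⟩ := hmem
    exact ⟨i, j, hij, hi.1, hj.1⟩
  · intro hs
    rw [EhrhartEquation]
    ext k
    rw [(h1 k).2, (h2 k).2]
    congr 2
    refine Set.Subset.antisymm ?_ (hsub k)
    rintro ⟨x, y⟩ ⟨⟨hx, hxP⟩, ⟨hy, hyQ⟩, hxy⟩
    obtain ⟨i, j, hij, hi, hj⟩ := hs k x hx y hy hxP hyQ hxy
    exact ⟨i, j, hij, ⟨hi, hx⟩, ⟨hj, hy⟩⟩

lemma ehrhartEquation_iff_dual (hP : IsRationalPolytope P) (hQ : IsRationalPolytope Q)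
    (h : IsFreeSum P Q) :
    EhrhartEquation P Q ↔ DualIsLatticePolyhedron P ∨ DualIsLatticePolyhedron Q := by
  obtain ⟨hP0, hQ0, hd, -⟩ := h.properties
  rw [ehrhartEquation_iff_latticePointsSplit hP.1 hQ.1 h, dualIsLatticePolyhedron_iff hP hP0,
    dualIsLatticePolyhedron_iff hQ hQ0]
  refine ⟨fun hs => hs.isGaugeIntegral_or hP.1 hQ.1 hP0 hQ0, ?_⟩
  rintro (h1 | h1)
  · exact h1.latticePointsSplit hP.1.convex hQ.1.convex hP0 hQ0 hd
  · exact (h1.latticePointsSplit hQ.1.convex hP.1.convex hQ0 hP0 hd.symm).symm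

end Series

/-! ### The `δ`-polynomial of a free sum -/

section Delta

variable {n : ℕ} {P Q : Set (Fin n → ℝ)}

lemma one_sub_X_pow_ne_zero {d : ℕ} (hd : 0 < d) :
    (1 - PowerSeries.X ^ d : PowerSeries ℚ) ≠ 0 := by
  intro h
  have := congrArg PowerSeries.constantCoeff h
  simp [hd.ne'] at this

lemma deltaEquation_iff_ehrhartEquation (hP : IsRationalPolytope P) (hQ : IsRationalPolytope Q)
    (h : IsFreeSum P Q) : DeltaEquation P Q ↔ EhrhartEquation P Q := by
  obtain ⟨hP0, hQ0, hd, -⟩ := h.properties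
  have hlcm : 0 < Nat.lcm (den P) (den Q) := Nat.lcm_pos hP.den_pos hQ.den_pos
  have hδ := (hP.oplus hQ).coe_delta ⟨0, zero_mem_oplus hP0⟩
  rw [den_oplus hP hQ hP0 hQ0 hd, dim_oplus hP0 hQ0 hd] at hδ
  have hδP := hP.coe_delta ⟨0, hP0⟩
  have hδQ := hQ.coe_delta ⟨0, hQ0⟩
  set p := dim P
  set q := dim Q
  set d := den P
  set e := den Q
  set m := Nat.lcm d e
  let D : Polynomial ℚ := (1 - Polynomial.X ^ d) ^ (p + 1) * (1 - Polynomial.X ^ e) ^ (q + 1)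
  let N : Polynomial ℚ := (1 - Polynomial.X) * (1 - Polynomial.X ^ m) ^ (p + q + 1)
  have hDc : (D : PowerSeries ℚ) =
      (1 - PowerSeries.X ^ d) ^ (p + 1) * (1 - PowerSeries.X ^ e) ^ (q + 1) := by
    simp [D]
  have hNc : (N : PowerSeries ℚ) =
      (1 - PowerSeries.X) * (1 - PowerSeries.X ^ m) ^ (p + q + 1) := by
    simp [N]
  have hD0' : (D : PowerSeries ℚ) ≠ 0 := by
    rw [hDc]
    exact mul_ne_zero (pow_ne_zero _ (one_sub_X_pow_ne_zero hP.den_pos))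
      (pow_ne_zero _ (one_sub_X_pow_ne_zero hQ.den_pos))
  have hD0 : D ≠ 0 := fun h => hD0' (by rw [h, Polynomial.coe_zero])
  have hDr : (1 - RatFunc.X ^ d) ^ (p + 1) * (1 - RatFunc.X ^ e) ^ (q + 1) =
      algebraMap (Polynomial ℚ) (RatFunc ℚ) D := by
    simp [D]
  have hNr : (1 - RatFunc.X) * (1 - RatFunc.X ^ m) ^ (p + q + 1) =
      algebraMap (Polynomial ℚ) (RatFunc ℚ) N := by
    simp [N]
  have hDr0 : algebraMap (Polynomial ℚ) (RatFunc ℚ) D ≠ 0 := by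
    simpa using hD0
  clear_value D N
  rw [DeltaEquation, hDr, hNr, div_mul_eq_mul_div, div_mul_eq_mul_div, eq_div_iff hDr0, ← map_mul,
    ← map_mul, ← map_mul, (IsFractionRing.injective (Polynomial ℚ) (RatFunc ℚ)).eq_iff,
    ← Polynomial.coe_inj, EhrhartEquation, Polynomial.coe_mul, Polynomial.coe_mul,
    Polynomial.coe_mul, hδ, hδP, hδQ, hNc]
  have hU0 : (1 - PowerSeries.X ^ m : PowerSeries ℚ) ^ (p + q + 1) ≠ 0 :=
    pow_ne_zero _ (one_sub_X_pow_ne_zero hlcm)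
  rw [hDc] at hD0' ⊢
  exact ⟨fun h => mul_right_cancel₀ (mul_ne_zero hU0 hD0') (by linear_combination h),
    fun h => by rw [h]; ring⟩

/-- For lattice polytopes all denominators are `1`, and the quotient in the equation of
`δ`-polynomials cancels. -/
lemma delta_eq_mul_iff_ehrhartEquation (hP : IsRationalPolytope P) (hQ : IsRationalPolytope Q)
    (h : IsFreeSum P Q) (hP1 : den P = 1) (hQ1 : den Q = 1) :
    delta (oplus P Q) = delta P * delta Q ↔ EhrhartEquation P Q := by
  obtain ⟨hP0, hQ0, hd, -⟩ := h.properties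
  have hδ := (hP.oplus hQ).coe_delta ⟨0, zero_mem_oplus hP0⟩
  rw [den_oplus hP hQ hP0 hQ0 hd, dim_oplus hP0 hQ0 hd, hP1, hQ1, Nat.lcm_self, pow_one] at hδ
  have hδP := hP.coe_delta ⟨0, hP0⟩
  have hδQ := hQ.coe_delta ⟨0, hQ0⟩
  rw [hP1, pow_one] at hδP
  rw [hQ1, pow_one] at hδQ
  rw [← Polynomial.coe_inj, Polynomial.coe_mul, hδ, hδP, hδQ, EhrhartEquation]
  have hX := one_sub_X_pow_ne_zero one_pos
  rw [pow_one] at hX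
  exact ⟨fun h => mul_right_cancel₀ (pow_ne_zero (dim P + dim Q + 1) hX)
    (by linear_combination h), fun h => by rw [h]; ring⟩

end Delta

end Ehrhart

theorem mainTheorem3 (n : ℕ) (P Q : Set (Fin n → ℝ))
    (hP : IsRationalPolytope P) (hQ : IsRationalPolytope Q) (hPQ : IsFreeSum P Q) :
    ((DualIsLatticePolyhedron P ∨ DualIsLatticePolyhedron Q) →
      EhrhartEquation P Q ∧ DeltaEquation P Q) ∧
    (EhrhartEquation P Q ∨ DeltaEquation P Q →
      DualIsLatticePolyhedron P ∨ DualIsLatticePolyhedron Q) ∧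
    (IsLatticePolytope P → IsLatticePolytope Q →
      (delta (oplus P Q) = delta P * delta Q ↔
        DualIsLatticePolyhedron P ∨ DualIsLatticePolyhedron Q)) := by
  rw [deltaEquation_iff_ehrhartEquation hP hQ hPQ, and_self, or_self,
    ehrhartEquation_iff_dual hP hQ hPQ]
  refine ⟨id, id, fun hP' hQ' => ?_⟩
  rw [delta_eq_mul_iff_ehrhartEquation hP hQ hPQ hP'.den_eq_one hQ'.den_eq_one,
    ehrhartEquation_iff_dual hP hQ hPQ]
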